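/- **Setting.** Let $p\ge 1$ and $n>p$, and let $X=(X_1,\dots,X_n)$ be i.i.d. $N_p(\theta,\Sigma)$ with $\Sigma$ unknown and positive definite. Test $H_0:\theta=0$ against $H_1:\theta\in\mathcal O_p^+\setminus\{0\}$, where $\mathcal O_p^+=\{\theta\in\mathbb R^p:\theta\ge 0\}$ (vector inequalities are coordinatewise). Let $\bar X=n^{-1}\sum_i X_i$, $S=(n-1)^{-1}\sum_i(X_i-\bar X)(X_i-\bar X)'$, $W=\sum_iX_iX_i'$, $z=(\bar X_j/\sqrt{S_{jj}})_{j}$, and let $R=(S_{ij}/\sqrt{S_{ii}S_{jj}})_{i,j}$ be the sample correlation matrix. $S$ is positive definite with probability one. **Tests.** For $x\in\mathbb R^p$, a matrix $S$ and $a\subseteq P=\{1,\dots,p\}$ with complement $a'$, put $x_{a:a'}=x_a-S_{aa'}S_{a'a'}^{-1}x_{a'}$ and $S_{aa:a'}=S_{aa}-S_{aa'}S_{a'a'}^{-1}S_{a'a}$, and $$U_n(x,S)=\sum_{\emptyset\subseteq a\subseteq P} n\,x_{a:a'}'S_{aa:a'}^{-1}x_{a:a'}\;\mathbf 1\{x_{a:a'}>0,\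 S_{a'a'}^{-1}x_{a'}\le 0\}.$$ The UIT with critical level $c\ge 0$ accepts $H_0$ iff $U_n(\bar X,S)\le c$. Here $c\ge0$ is arbitrary; in particular it may be the critical level $c_\alpha$ of the UIT of a given size $\alpha$. Let $\mathcal A_U(S)=\{x:U_n(x,S)\le c\}$. For $0<\alpha<1$ let $t=t_{n-1,\alpha/p}$ be the upper $100(\alpha/p)\%$ point of Student's t-distribution with $n-1$ degrees of freedom. The FUIT rejects $H_0$ iff $\sqrt n\,\bar X_j/\sqrt{S_{jj}}\ge t$ for some $j$; let $\mathcal A^*(S)=\{x:\sqrt n\,x_j/\sqrt{S_{jj}}\le t\ \text{for all } j\}$. **Eaton's class.** For a set $M$ of positive definite matrices (the admitted dispersion matrices) let $\Omega_1=\{\Sigma^{-1}\theta:\Sigma\in M,\ \theta\in\mathcal O_p^+\}\setminus\{0\}$, let $\mathcal V_M$ be the smallest closed convex cone containing $\Omega_1$, and let $\mathcal V_M^-=\{w:\langle w,x\rangle\le 0\ \forall x\in\mathcal V_M\}$. For a cone $K$, call $A\subseteq\mathbb R^p$ a *$K$-region* if $A$ is closed and convex and $K\subseteq A-a$ for every boundary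 point $a$ of $A$. For a statistic $y$ with values in $\mathbb R^p$ and a matrix-valued nuisance statistic $T$, Eaton's class $\Phi(M;y\mid T)$ is the set of all measurable tests $\varphi$ with values in $[0,1]$ such that for every value $\tau$ of $T$ there is a $\mathcal V_M^-$-region $C$ such that, for all samples with $T=\tau$ and $S$ positive definite, $\varphi=1$ if $y\notin C$ and $\varphi=0$ if $y$ is in the interior of $C$. **Theorem.** Let $\mathcal M$ be the set of all positive definite $p\times p$ matrices and $\mathcal R$ the set of all positive definite correlation matrices. 1. The UIT and the FUIT both belong to Eaton's class: each is a member of $\Phi(\mathcal M;\bar X\mid W)$ (the class for the canonical statistic of the exponential family), of $\Phi(\mathcal M;\bar X\mid S)$, and of $\Phi(\mathcal R; z\mid R)$ (the class after the reduction of $\Sigma$ to a correlation matrix). 2. Let $M\subseteq\mathcal M$ contain the identity matrix, for example $M=\mathcal M$ or $M=\mathcal R$, and let $S\in M$. With $\mathcal V_n^-(S)=\{x:S^{-1}x\le 0\}$ and $\mathbb R_p^-=\{x:x\le 0\}$, $$\mathcal V_M^-\subseteq\mathcal V_n^-(S)\subseteq\mathcal A_U(S),\qquad \mathcal V_M^-\subseteq\mathbb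 R_p^-,\qquad \mathbb R_p^-\subseteq\mathcal A^*(S)\ \text{ if }\alpha\le p/2 .$$ Moreover, $\mathcal A_U(S)$ is a $\mathcal V_n^-(S)$-region and $\mathcal A^*(S)$ is an $\mathbb R_p^-$-region. -/

import Mathlib

open MeasureTheory ProbabilityTheory Matrix

noncomputable section

namespace OneSidedMean

/-- Column vectors of `ℝᵖ`; inequalities between vectors are coordinatewise and `⬝ᵥ` is the
standard inner product. -/
abbrev Vec (p : ℕ) : Type := Fin p → ℝ

/-- Real `p × p` matrices. -/
abbrev Mat (p : ℕ) : Type := Matrix (Fin p) (Fin p) ℝ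

/-- Samples `X = (X₁, …, Xₙ)` of `n` vectors of `ℝᵖ`. -/
abbrev Sample (n p : ℕ) : Type := Fin n → Vec p

/-! ### Statistics of a sample -/

/-- The sample mean. -/
def sampleMean {n p : ℕ} (X : Sample n p) : Vec p := (n : ℝ)⁻¹ • ∑ i, X i

/-- The sample covariance matrix, with divisor `n - 1`. -/
def sampleCov {n p : ℕ} (X : Sample n p) : Mat p :=
  ((n : ℝ) - 1)⁻¹ • ∑ i, vecMulVec (X i - sampleMean X) (X i - sampleMean X)

/-- The matrix `∑ᵢ Xᵢ Xᵢ'`. With the sample mean it forms the canonical sufficient statistic of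
the normal exponential family, whose canonical parameter is `(n Σ⁻¹ θ, -½ Σ⁻¹)`. -/
def sumSquares {n p : ℕ} (X : Sample n p) : Mat p := ∑ i, vecMulVec (X i) (X i)

/-- The coordinates of the sample mean divided by the sample standard deviations. -/
def scaledMean {n p : ℕ} (X : Sample n p) : Vec p :=
  fun j => sampleMean X j / √(sampleCov X j j)

/-- The sample correlation matrix. -/
def sampleCorr {n p : ℕ} (X : Sample n p) : Mat p :=
  Matrix.of fun i j => sampleCov X i j / (√(sampleCov X i i) * √(sampleCov X j j))

/-! ### The cones of the testing problem `θ = 0` against `θ ≥ 0, θ ≠ 0` -/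

/-- The positive definite matrices. -/
def posDefs (p : ℕ) : Set (Mat p) := {S | S.PosDef}

/-- The positive definite correlation matrices. -/
def corrs (p : ℕ) : Set (Mat p) := {S | S.PosDef ∧ ∀ i, S i i = 1}

/-- The set of all nonzero `Σ⁻¹ θ`, for `θ` in the positive orthant and `Σ` in the set `M` of
admitted dispersion matrices. -/
def altSet {p : ℕ} (M : Set (Mat p)) : Set (Vec p) :=
  {v | ∃ S ∈ M, ∃ θ : Vec p, 0 ≤ θ ∧ v = S⁻¹ *ᵥ θ} \ {0}

/-- The smallest closed convex cone that contains `altSet M`. -/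
def altCone {p : ℕ} (M : Set (Mat p)) : Set (Vec p) :=
  ⋂ (K : ProperCone ℝ (Vec p)) (_ : altSet M ⊆ (K : Set (Vec p))), (K : Set (Vec p))

/-- The dual cone `V⁻ = {w | ⟨w, x⟩ ≤ 0 for all x ∈ V}` of `V = altCone M`. -/
def dualCone {p : ℕ} (M : Set (Mat p)) : Set (Vec p) :=
  {w | ∀ x ∈ altCone M, w ⬝ᵥ x ≤ 0}

/-- The cone `{x | S⁻¹ x ≤ 0}`. -/
def pivotCone {p : ℕ} (S : Mat p) : Set (Vec p) := {x | S⁻¹ *ᵥ x ≤ 0}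

/-! ### Eaton's class of tests -/

/-- `A` is closed and convex, and `K ⊆ A - a` for every boundary point `a` of `A`. -/
def IsEatonRegion {p : ℕ} (K A : Set (Vec p)) : Prop :=
  IsClosed A ∧ Convex ℝ A ∧ ∀ a ∈ frontier A, ∀ w ∈ K, a + w ∈ A

/-- Eaton's class of (randomized) tests based on the statistic `y`, given the nuisance statistic
`T`, when `M` is the set of admitted dispersion matrices. A test `φ` belongs to it if, for each
value `τ` of `T`, it accepts in the interior and rejects outside of a closed convex set `C` that
satisfies the cone condition for the dual cone of `M`; on the boundary of `C` it is arbitrary.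
Only samples with a positive definite covariance matrix are looked at. For `n > p` those are
almost all samples under every parameter. -/
def eatonClass {n p : ℕ} (M : Set (Mat p)) (y : Sample n p → Vec p) (T : Sample n p → Mat p) :
    Set (Sample n p → ℝ) :=
  {φ | Measurable φ ∧ (∀ X, φ X ∈ Set.Icc (0 : ℝ) 1) ∧
    ∀ τ : Mat p, ∃ C : Set (Vec p), IsEatonRegion (dualCone M) C ∧
      ∀ X, (sampleCov X).PosDef → T X = τ →
        (y X ∉ C → φ X = 1) ∧ (y X ∈ interior C → φ X = 0)}

/-! ### The union-intersection test -/

/-- The residual `x_{a:a'} = x_a - S_{aa'} S_{a'a'}⁻¹ x_{a'}`, where `a'` is the complement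
of `a`. -/
def resVec {p : ℕ} (x : Vec p) (S : Mat p) (a : Finset (Fin p)) : {i // i ∈ a} → ℝ :=
  (fun i : {i // i ∈ a} => x i) -
    S.toBlock (· ∈ a) (· ∉ a) *ᵥ ((S.toBlock (· ∉ a) (· ∉ a))⁻¹ *ᵥ fun i : {i // i ∉ a} => x i)

/-- The Schur complement `S_{aa:a'} = S_{aa} - S_{aa'} S_{a'a'}⁻¹ S_{a'a}`. -/
def resMat {p : ℕ} (S : Mat p) (a : Finset (Fin p)) : Matrix {i // i ∈ a} {i // i ∈ a} ℝ :=
  S.toBlock (· ∈ a) (· ∈ a) -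
    S.toBlock (· ∈ a) (· ∉ a) * (S.toBlock (· ∉ a) (· ∉ a))⁻¹ * S.toBlock (· ∉ a) (· ∈ a)

/-- The event `x_{a:a'} > 0` and `S_{a'a'}⁻¹ x_{a'} ≤ 0`. -/
def UITCell {p : ℕ} (x : Vec p) (S : Mat p) (a : Finset (Fin p)) : Prop :=
  (∀ i, 0 < resVec x S a i) ∧
    ∀ i, ((S.toBlock (· ∉ a) (· ∉ a))⁻¹ *ᵥ fun i : {i // i ∉ a} => x i) i ≤ 0

open Classical in
/-- The union-intersection statistic
`U = ∑_{∅ ⊆ a ⊆ P} n x_{a:a'}' S_{aa:a'}⁻¹ x_{a:a'} 1{x_{a:a'} > 0, S_{a'a'}⁻¹ x_{a'} ≤ 0}`. -/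
def uitStat {p : ℕ} (n : ℕ) (x : Vec p) (S : Mat p) : ℝ :=
  ∑ a : Finset (Fin p),
    if UITCell x S a then n * (resVec x S a ⬝ᵥ ((resMat S a)⁻¹ *ᵥ resVec x S a)) else 0

/-- The section at `S` of the acceptance region of the UIT with critical level `c`. -/
def uitRegion {p : ℕ} (n : ℕ) (c : ℝ) (S : Mat p) : Set (Vec p) := {x | uitStat n x S ≤ c}

open Classical in
/-- The UIT with critical level `c`: it rejects if and only if `U > c`. -/
def uitTest (n p : ℕ) (c : ℝ) (X : Sample n p) : ℝ :=
  if sampleMean X ∈ uitRegion n c (sampleCov X) then 0 else 1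

/-! ### The finite union-intersection test -/

/-- Student's t-distribution with `ν` degrees of freedom: the law of `Z / √(Y / ν)` for
independent `Z`, standard normal, and `Y`, chi-squared with `ν` degrees of freedom (that is,
Gamma with shape `ν / 2` and rate `1 / 2`). -/
def studentT (ν : ℕ) : Measure ℝ :=
  ((gaussianReal 0 1).prod (gammaMeasure ((ν : ℝ) / 2) (1 / 2))).map
    fun w => w.1 / √(w.2 / ν)

/-- `t` is an upper `100 β` per cent point of Student's t-distribution with `ν` degrees of
freedom. -/
def IsUpperTPoint (ν : ℕ) (β t : ℝ) : Prop := studentT ν (Set.Ici t) = ENNReal.ofReal β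

/-- The coordinatewise t-statistic `√n x_j / √S_jj`. -/
def tStat {p : ℕ} (n : ℕ) (x : Vec p) (S : Mat p) (j : Fin p) : ℝ := √n * x j / √(S j j)

/-- The section at `S` of the (closed) acceptance region of the FUIT with critical point `t`. -/
def fuitRegion {p : ℕ} (n : ℕ) (t : ℝ) (S : Mat p) : Set (Vec p) :=
  {x | ∀ j, tStat n x S j ≤ t}

open Classical in
/-- The FUIT with critical point `t`: it rejects if and only if one of the one-sided coordinatewise
t-tests rejects. -/
def fuitTest (n p : ℕ) (t : ℝ) (X : Sample n p) : ℝ :=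
  if ∃ j, t ≤ tStat n (sampleMean X) (sampleCov X) j then 1 else 0

end OneSidedMean

end

noncomputable section

namespace OneSidedMean

/-! ### Positive definite matrices -/

/-! An intersection of half-spaces `u·x ≤ r` whose normals `u` are nonpositive on a cone `K` is a
`K`-region (`isEatonRegion_of_halfSpaces`). So each conditional acceptance region is written in this
form.

UIT given `S`. Decompose `x = y + S l` with `y ≥ 0`, `l ≤ 0`, `y·l = 0`. The support of `y` is the
only cell containing `x`, so `U = n y'S⁻¹y` (`uitStat_eq`), and by duality `U ≤ c` iff `√n b·x ≤ √c
√(b'Sb)` for every `b` with `S b ≥ 0` (`mem_uitRegion_iff`). Given `R`, scale invariance reduces to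
this case.

UIT given `W`. Now `(n-1) S = W - n x x'` moves with `x`. Decompose `x = y + W μ` relative to `W`
and put `m = y'W⁻¹y`, `v = 1 - n μ'Wμ`. The decomposition relative to `S` is a rescaling of this
one, which gives `U = n(n-1)m / (v(v - nm))`. Hence `U ≤ c` iff `√(nm) ≤ √c v/√(n-1+cv)`. The left
side is a supremum of linear functions of `x`. The right side is increasing and concave in `v`, and
`v` is an infimum of affine functions of `x`; replacing both by affine upper bounds yields
half-spaces with normals `√n b + s μ`, `s ≥ 0`. The term `μ ≤ 0` could have the wrong sign on the
dual cone, but for `p ≥ 2` that cone is `{0}`, and for `p = 1` either `y = 0` or `μ = 0`.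

FUIT. Each t-statistic is increasing in its coordinate of the mean (or of `z`) given `S`, `W` or
`R`, so the region is a translate of the negative orthant. That orthant contains the dual cone
because `1 ∈ M`. -/

lemma dotProduct_mulVec_comm_of_posDef {p : ℕ} {S : Mat p} (hS : S.PosDef) (v w : Vec p) :
    v ⬝ᵥ S *ᵥ w = w ⬝ᵥ S *ᵥ v := by
  have h : Sᵀ = S := by simpa [IsHermitian, conjTranspose_eq_transpose_of_trivial] using hS.1
  rw [dotProduct_mulVec, ← mulVec_transpose, h, dotProduct_comm]

lemma dotProduct_mulVec_self_nonneg {p : ℕ} {S : Mat p} (hS : S.PosDef) (v : Vec p) :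
    0 ≤ v ⬝ᵥ S *ᵥ v := by
  simpa using hS.posSemidef.dotProduct_mulVec_nonneg v

lemma dotProduct_mulVec_self_pos {p : ℕ} {S : Mat p} (hS : S.PosDef) {v : Vec p} (hv : v ≠ 0) :
    0 < v ⬝ᵥ S *ᵥ v := by
  simpa using hS.dotProduct_mulVec_pos hv

lemma mulVec_inv_mulVec {p : ℕ} {S : Mat p} (hS : S.PosDef) (v : Vec p) :
    S *ᵥ (S⁻¹ *ᵥ v) = v := by
  have := (Matrix.isUnit_iff_isUnit_det S).1 hS.isUnit
  rw [mulVec_mulVec, Matrix.mul_nonsing_inv _ this, one_mulVec]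

lemma inv_mulVec_mulVec {p : ℕ} {S : Mat p} (hS : S.PosDef) (v : Vec p) :
    S⁻¹ *ᵥ (S *ᵥ v) = v := by
  have := (Matrix.isUnit_iff_isUnit_det S).1 hS.isUnit
  rw [mulVec_mulVec, Matrix.nonsing_inv_mul _ this, one_mulVec]

/-- Cauchy–Schwarz: the quadratic `t ↦ (v + t w)'S(v + t w)` is nonnegative, so its discriminant is
at most zero. -/
lemma dotProduct_le_sqrt_mul_sqrt {p : ℕ} {S : Mat p} (hS : S.PosDef) (v w : Vec p) :
    v ⬝ᵥ S *ᵥ w ≤ √(v ⬝ᵥ S *ᵥ v) * √(w ⬝ᵥ S *ᵥ w) := by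
  have hv := dotProduct_mulVec_self_nonneg hS v
  rw [← Real.sqrt_mul hv]
  refine Real.le_sqrt_of_sq_le ?_
  have key : ∀ t : ℝ, 0 ≤ (w ⬝ᵥ S *ᵥ w) * (t * t) + (2 * (v ⬝ᵥ S *ᵥ w)) * t + v ⬝ᵥ S *ᵥ v := by
    intro t
    have h := dotProduct_mulVec_self_nonneg hS (v + t • w)
    have hc := dotProduct_mulVec_comm_of_posDef hS w v
    simp only [mulVec_add, mulVec_smul, dotProduct_add, add_dotProduct, dotProduct_smul,
      smul_dotProduct, smul_eq_mul, hc] at h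
    linarith
  have := discrim_le_zero key
  rw [discrim] at this
  linarith

/-! ### Decomposition along the orthant and its polar cone -/

/-- `x = y + S l` is the decomposition of `x`, with respect to the inner product of `S⁻¹`, along
the positive orthant and its polar cone. -/
structure IsMoreauPair {p : ℕ} (S : Mat p) (x y l : Vec p) : Prop where
  nonneg : 0 ≤ y
  nonpos : l ≤ 0
  orth : y ⬝ᵥ l = 0
  eq_add : x = y + S *ᵥ l

lemma dotProduct_nonpos_of_nonneg_of_nonpos {ι : Type*} [Fintype ι] {y l : ι → ℝ} (hy : 0 ≤ y)
    (hl : l ≤ 0) : y ⬝ᵥ l ≤ 0 :=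
  Finset.sum_nonpos fun i _ => mul_nonpos_of_nonneg_of_nonpos (hy i) (hl i)

lemma IsMoreauPair.apply_mul_apply_eq_zero {p : ℕ} {S : Mat p} {x y l : Vec p} (h : IsMoreauPair S x y l)
    (i : Fin p) : y i * l i = 0 := by
  have h0 : ∀ i ∈ Finset.univ, y i * l i ≤ 0 := fun i _ =>
    mul_nonpos_of_nonneg_of_nonpos (h.nonneg i) (h.nonpos i)
  exact (Finset.sum_eq_zero_iff_of_nonpos h0).1 h.orth i (Finset.mem_univ i)

/-- By complementarity, `(l - l₂)'S(l - l₂) = (l - l₂)·(y₂ - y) = l·y₂ + l₂·y ≤ 0`. -/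
lemma IsMoreauPair.unique {p : ℕ} {S : Mat p} (hS : S.PosDef) {x y l y₂ l₂ : Vec p}
    (h : IsMoreauPair S x y l) (h₂ : IsMoreauPair S x y₂ l₂) : y = y₂ ∧ l = l₂ := by
  have hl : l = l₂ := by
    by_contra hne
    have hpos := dotProduct_mulVec_self_pos hS (sub_ne_zero.2 hne)
    have e : S *ᵥ (l - l₂) = y₂ - y := by
      have := h.eq_add.symm.trans h₂.eq_add
      rw [mulVec_sub, sub_eq_sub_iff_add_eq_add, add_comm, this, add_comm]
    rw [e] at hpos
    simp only [dotProduct_sub, sub_dotProduct] at hpos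
    have a := dotProduct_nonpos_of_nonneg_of_nonpos h₂.nonneg h.nonpos
    have b := dotProduct_nonpos_of_nonneg_of_nonpos h.nonneg h₂.nonpos
    have c := h.orth
    have d := h₂.orth
    rw [dotProduct_comm] at a b c d
    linarith
  refine ⟨?_, hl⟩
  have := h.eq_add.symm.trans h₂.eq_add
  rw [hl] at this
  exact add_right_cancel this

-- With `S = BᵀB`, project `(Bᵀ)⁻¹x` onto the closed convex cone `{B l : l ≤ 0}` in Euclidean space.
open scoped MatrixOrder in
lemma exists_isMoreauPair {p : ℕ} {S : Mat p} (hS : S.PosDef) (x : Vec p) :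
    ∃ y l, IsMoreauPair S x y l := by
  obtain ⟨B, hB⟩ := CStarAlgebra.nonneg_iff_eq_star_mul_self.mp hS.posSemidef.nonneg
  have hBT : S = Bᵀ * B := by
    rw [hB, star_eq_conjTranspose, conjTranspose_eq_transpose_of_trivial]
  have hdet : IsUnit B.det := by
    have := (Matrix.isUnit_iff_isUnit_det S).1 hS.isUnit
    rw [hBT, det_mul] at this
    exact isUnit_of_mul_isUnit_right this
  have hdetT : IsUnit Bᵀ.det := by rwa [det_transpose]
  let K : Set (EuclideanSpace ℝ (Fin p)) := {w | ∀ i, (B⁻¹ *ᵥ w.ofLp) i ≤ 0}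
  have hcl : IsClosed K := by
    simp only [K, Set.ofPred_forall]
    refine isClosed_iInter fun i => isClosed_le ?_ continuous_const
    simp only [mulVec, dotProduct]
    fun_prop
  have hcv : Convex ℝ K := by
    intro v hv w hw a b ha hb _ i
    have : (B⁻¹ *ᵥ (a • v + b • w).ofLp) i = a * (B⁻¹ *ᵥ v.ofLp) i + b * (B⁻¹ *ᵥ w.ofLp) i := by
      simp [mulVec_add, mulVec_smul]
    rw [this]
    nlinarith [hv i, hw i]
  obtain ⟨v, hv, hmin⟩ := exists_norm_eq_iInf_of_complete_convex (K := K) ⟨0, by simp [K]⟩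
    hcl.isComplete hcv (WithLp.toLp 2 ((Bᵀ)⁻¹ *ᵥ x))
  rw [norm_eq_iInf_iff_real_inner_le_zero hcv hv] at hmin
  set l : Vec p := B⁻¹ *ᵥ v.ofLp with hl
  have hBl : B *ᵥ l = v.ofLp := by
    rw [hl, mulVec_mulVec, mul_nonsing_inv _ hdet, one_mulVec]
  -- The variational inequality of the projection. Testing `m = l - eᵢ` gives `y ≥ 0`; testing `m =
  -- 0` and `m = 2l` gives orthogonality.
  have var : ∀ m : Vec p, m ≤ 0 → (x - S *ᵥ l) ⬝ᵥ (m - l) ≤ 0 := by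
    intro m hm
    have h := hmin (WithLp.toLp 2 (B *ᵥ m)) (by
      intro i
      simpa [mulVec_mulVec, nonsing_inv_mul _ hdet] using hm i)
    have e1 : (WithLp.toLp 2 ((Bᵀ)⁻¹ *ᵥ x) - v : EuclideanSpace ℝ (Fin p)).ofLp
        = (Bᵀ)⁻¹ *ᵥ x - B *ᵥ l := by simp [hBl]
    have e2 : (WithLp.toLp 2 (B *ᵥ m) - v : EuclideanSpace ℝ (Fin p)).ofLp
        = B *ᵥ (m - l) := by simp [hBl, mulVec_sub]
    rw [EuclideanSpace.inner_eq_star_dotProduct, e1, e2] at h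
    simp only [star_trivial] at h
    rw [dotProduct_comm, dotProduct_mulVec, ← mulVec_transpose, mulVec_sub, mulVec_mulVec,
      mulVec_mulVec, mul_nonsing_inv _ hdetT, one_mulVec, ← hBT] at h
    exact h
  have hl0 : l ≤ 0 := fun i => hv i
  refine ⟨x - S *ᵥ l, l, ?_, hl0, ?_, by simp⟩
  · intro i
    have h := var (l - Pi.single i 1) (by
      intro j
      have : (0 : ℝ) ≤ (Pi.single i 1 : Vec p) j := by
        by_cases h : j = i
        · subst h; simp
        · simp [h]
      have := hl0 j
      simp only [Pi.sub_apply, Pi.zero_apply] at this ⊢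
      linarith)
    simpa using h
  · have h1 := var 0 le_rfl
    have h2 := var ((2 : ℝ) • l) (by
      intro j
      have := hl0 j
      simp only [Pi.smul_apply, Pi.zero_apply, smul_eq_mul] at this ⊢
      linarith)
    rw [two_smul, add_sub_cancel_right] at h2
    rw [zero_sub, dotProduct_neg] at h1
    linarith

/-! ### The cells of the union-intersection statistic -/

/-- Extension by zero of a vector indexed by a set of coordinates. -/
def extendZero {p : ℕ} {q : Fin p → Prop} [DecidablePred q] (u : {i // q i} → ℝ) : Vec p :=
  fun i => if h : q i then u ⟨i, h⟩ else 0

lemma toBlock_mulVec {p : ℕ} {r q : Fin p → Prop} [DecidablePred q]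
    [Fintype {i // q i}] (S : Mat p) (u : {i // q i} → ℝ) (i : {i // r i}) :
    (S.toBlock r q *ᵥ u) i = (S *ᵥ extendZero u) i := by
  simp only [mulVec, dotProduct, toBlock_apply]
  rw [← Fintype.sum_subtype_add_sum_subtype q (fun j => S i j * extendZero u j)]
  rw [Finset.sum_eq_zero (s := (Finset.univ : Finset {j // ¬ q j})), add_zero]
  · refine Finset.sum_congr (by ext; simp) fun j _ => ?_
    simp [extendZero, j.2]
  · intro j _
    simp [extendZero, j.2]

lemma extendZero_dotProduct {p : ℕ} {q : Fin p → Prop} [DecidablePred q]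
    [Fintype {i // q i}] (u : {i // q i} → ℝ) (v : Vec p) : extendZero u ⬝ᵥ v = u ⬝ᵥ fun i => v i := by
  simp only [dotProduct]
  rw [← Fintype.sum_subtype_add_sum_subtype q (fun j => extendZero u j * v j)]
  rw [Finset.sum_eq_zero (s := (Finset.univ : Finset {j // ¬ q j})), add_zero]
  · refine Finset.sum_congr (by ext; simp) fun j _ => ?_
    simp [extendZero, j.2]
  · intro j _
    simp [extendZero, j.2]

lemma toBlock_posDef {p : ℕ} {S : Mat p} (hS : S.PosDef) (q : Fin p → Prop) :
    (S.toBlock q q).PosDef :=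
  hS.submatrix Subtype.val_injective

lemma toBlock_det_isUnit {p : ℕ} {S : Mat p} (hS : S.PosDef) (q : Fin p → Prop)
    [Fintype {i // q i}] : IsUnit (S.toBlock q q).det :=
  (Matrix.isUnit_iff_isUnit_det _).1 (toBlock_posDef hS q).isUnit

lemma IsMoreauPair.of_uitCell {p : ℕ} {S : Mat p} (hS : S.PosDef) {x : Vec p}
    {a : Finset (Fin p)} (h : UITCell x S a) :
    IsMoreauPair S x (extendZero (q := (· ∈ a)) (resVec x S a))
      (extendZero (q := (· ∉ a))
        ((S.toBlock (· ∉ a) (· ∉ a))⁻¹ *ᵥ fun i : {i // i ∉ a} => x i)) := by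
  refine ⟨fun i => ?_, fun i => ?_, ?_, ?_⟩
  · by_cases hi : i ∈ a
    · simpa [extendZero, hi] using (h.1 ⟨i, hi⟩).le
    · simp [extendZero, hi]
  · by_cases hi : i ∈ a
    · simp [extendZero, hi]
    · simpa [extendZero, hi] using h.2 ⟨i, hi⟩
  · refine Finset.sum_eq_zero fun i _ => ?_
    by_cases hi : i ∈ a <;> simp [extendZero, hi]
  · ext i
    by_cases hi : i ∈ a
    · have := toBlock_mulVec (r := (· ∈ a)) (q := (· ∉ a)) S
        ((S.toBlock (· ∉ a) (· ∉ a))⁻¹ *ᵥ fun i : {i // i ∉ a} => x i) ⟨i, hi⟩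
      rw [Pi.add_apply, ← this]
      simp [extendZero, hi, resVec]
    · have := toBlock_mulVec (r := (· ∉ a)) (q := (· ∉ a)) S
        ((S.toBlock (· ∉ a) (· ∉ a))⁻¹ *ᵥ fun i : {i // i ∉ a} => x i) ⟨i, hi⟩
      rw [Pi.add_apply, ← this, mulVec_mulVec,
        mul_nonsing_inv _ (toBlock_det_isUnit hS (· ∉ a)), one_mulVec]
      simp [extendZero, hi]

/-- Complementarity puts `l` on the complement of the support of `y`, so `x = y + S l` restricted to
that complement determines `l` by inverting `S_{a'a'}`. -/
lemma IsMoreauPair.uitCell {p : ℕ} {S : Mat p} (hS : S.PosDef) {x y l : Vec p}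
    (h : IsMoreauPair S x y l) : UITCell x S (Finset.univ.filter fun i => 0 < y i) := by
  set a : Finset (Fin p) := Finset.univ.filter fun i => 0 < y i with ha
  have hy : ∀ i, i ∉ a → y i = 0 := fun i hi => by
    have := h.nonneg i
    simp [ha] at hi
    exact le_antisymm hi this
  have hl : ∀ i, i ∈ a → l i = 0 := fun i hi => by
    have := h.apply_mul_apply_eq_zero i
    simp [ha] at hi
    exact (mul_eq_zero.1 this).resolve_left hi.ne'
  have hext : extendZero (q := (· ∉ a)) (fun i : {i // i ∉ a} => l i) = l := by
    ext i
    by_cases hi : i ∈ a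
    · simp [extendZero, hi, hl i hi]
    · simp [extendZero, hi]
  have hlam : (S.toBlock (· ∉ a) (· ∉ a))⁻¹ *ᵥ (fun i : {i // i ∉ a} => x i)
      = fun i : {i // i ∉ a} => l i := by
    have : (fun i : {i // i ∉ a} => x i)
        = S.toBlock (· ∉ a) (· ∉ a) *ᵥ fun i : {i // i ∉ a} => l i := by
      ext i
      rw [toBlock_mulVec, hext, h.eq_add, Pi.add_apply, hy i i.2, zero_add]
    rw [this, mulVec_mulVec, nonsing_inv_mul _ (toBlock_det_isUnit hS (· ∉ a)), one_mulVec]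
  refine ⟨fun i => ?_, fun i => ?_⟩
  · rw [resVec, hlam, Pi.sub_apply, toBlock_mulVec, hext, h.eq_add, Pi.add_apply,
      add_sub_cancel_right]
    exact (Finset.mem_filter.1 i.2).2
  · rw [hlam]
    exact h.nonpos i

/-- Block elimination: the `a'`-part is chosen so that `S` annihilates it there, leaving the Schur
complement on `a`. -/
lemma resMat_mulVec {p : ℕ} {S : Mat p} (hS : S.PosDef) (a : Finset (Fin p))
    (u : {i // i ∈ a} → ℝ) :
    S *ᵥ (extendZero (q := (· ∈ a)) u - extendZero (q := (· ∉ a))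
      ((S.toBlock (· ∉ a) (· ∉ a))⁻¹ *ᵥ (S.toBlock (· ∉ a) (· ∈ a) *ᵥ u)))
      = extendZero (q := (· ∈ a)) (resMat S a *ᵥ u) := by
  ext i
  by_cases hi : i ∈ a
  · have h1 := toBlock_mulVec (r := (· ∈ a)) (q := (· ∈ a)) S u ⟨i, hi⟩
    have h2 := toBlock_mulVec (r := (· ∈ a)) (q := (· ∉ a)) S
      ((S.toBlock (· ∉ a) (· ∉ a))⁻¹ *ᵥ (S.toBlock (· ∉ a) (· ∈ a) *ᵥ u)) ⟨i, hi⟩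
    rw [mulVec_sub, Pi.sub_apply, ← h1, ← h2]
    simp [extendZero, hi, resMat, sub_mulVec, mulVec_mulVec, Matrix.mul_assoc]
  · have h1 := toBlock_mulVec (r := (· ∉ a)) (q := (· ∈ a)) S u ⟨i, hi⟩
    have h2 := toBlock_mulVec (r := (· ∉ a)) (q := (· ∉ a)) S
      ((S.toBlock (· ∉ a) (· ∉ a))⁻¹ *ᵥ (S.toBlock (· ∉ a) (· ∈ a) *ᵥ u)) ⟨i, hi⟩
    rw [mulVec_sub, Pi.sub_apply, ← h1, ← h2,
      mulVec_mulVec _ (S.toBlock (· ∉ a) (· ∉ a)) (S.toBlock (· ∉ a) (· ∉ a))⁻¹, mul_nonsing_inv _ (toBlock_det_isUnit hS (· ∉ a)), one_mulVec, sub_self]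
    simp [extendZero, hi]

lemma resMat_isUnit_det {p : ℕ} {S : Mat p} (hS : S.PosDef) (a : Finset (Fin p)) :
    IsUnit (resMat S a).det := by
  rw [isUnit_iff_ne_zero]
  intro h0
  obtain ⟨u, hu, hu0⟩ := exists_mulVec_eq_zero_iff.2 h0
  have h := resMat_mulVec hS a u
  have hz : extendZero (q := (· ∈ a)) (resMat S a *ᵥ u) = 0 := by
    rw [hu0]; ext i; simp [extendZero]
  rw [hz] at h
  have h' := congrArg (fun v => S⁻¹ *ᵥ v) h
  simp only [inv_mulVec_mulVec hS, mulVec_zero] at h'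
  apply hu
  ext i
  have := congrFun h' i
  simpa [extendZero] using this

lemma uitStat_eq {p : ℕ} {S : Mat p} (hS : S.PosDef) (n : ℕ) {x y l : Vec p}
    (h : IsMoreauPair S x y l) : uitStat n x S = n * (y ⬝ᵥ S⁻¹ *ᵥ y) := by
  classical
  set a : Finset (Fin p) := Finset.univ.filter fun i => 0 < y i with ha
  have hcell : UITCell x S a := h.uitCell hS
  have huniq : ∀ b, UITCell x S b → b = a := by
    intro b hb
    have hy := (h.unique hS (IsMoreauPair.of_uitCell hS hb)).1
    ext i
    simp only [ha, Finset.mem_filter, Finset.mem_univ, true_and]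
    rw [hy]
    by_cases hi : i ∈ b
    · simpa [extendZero, hi] using hb.1 ⟨i, hi⟩
    · simp [extendZero, hi]
  have hy := (h.unique hS (IsMoreauPair.of_uitCell hS hcell)).1
  rw [uitStat, Finset.sum_eq_single a]
  · rw [if_pos hcell]
    congr 1
    -- `u` is the `a`-part of `S⁻¹y`; nothing else matters in `y'S⁻¹y`, since `y` vanishes off `a`.
    set u := (resMat S a)⁻¹ *ᵥ resVec x S a with hu
    have hmu : resMat S a *ᵥ u = resVec x S a := by
      rw [hu, mulVec_mulVec, mul_nonsing_inv _ (resMat_isUnit_det hS a), one_mulVec]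
    have e := resMat_mulVec hS a u
    rw [hmu, ← hy] at e
    rw [← e, inv_mulVec_mulVec hS, e]
    conv_rhs => rw [hy]
    rw [extendZero_dotProduct]
    congr 1
    ext i
    simp [extendZero, hu]
  · intro b _ hb
    rw [if_neg fun hc => hb (huniq b hc)]
  · intro h'
    exact absurd (Finset.mem_univ a) h'

/-! ### Intersections of half-spaces -/

lemma isEatonRegion_of_halfSpaces {p : ℕ} {κ : Sort*} {K C : Set (Vec p)} (u : κ → Vec p)
    (r : κ → ℝ) (hC : ∀ x, x ∈ C ↔ ∀ k, u k ⬝ᵥ x ≤ r k) (hK : ∀ k, ∀ w ∈ K, u k ⬝ᵥ w ≤ 0) :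
    IsEatonRegion K C := by
  have hcl : IsClosed C := by
    have : C = ⋂ k, {x | u k ⬝ᵥ x ≤ r k} := by
      ext x; simp [hC]
    rw [this]
    exact isClosed_iInter fun k =>
      isClosed_le (continuous_const.dotProduct continuous_id) continuous_const
  refine ⟨hcl, ?_, ?_⟩
  · intro x hx y hy a b ha hb hab
    rw [hC] at hx hy ⊢
    intro k
    rw [dotProduct_add, dotProduct_smul, dotProduct_smul, smul_eq_mul, smul_eq_mul]
    calc a * (u k ⬝ᵥ x) + b * (u k ⬝ᵥ y) ≤ a * r k + b * r k := by
          gcongr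
          · exact hx k
          · exact hy k
      _ = r k := by rw [← add_mul, hab, one_mul]
  · intro a ha w hw
    have ha' := (hC a).1 (hcl.frontier_subset ha)
    rw [hC]
    intro k
    rw [dotProduct_add]
    linarith [ha' k, hK k w hw]

lemma isEatonRegion_univ {p : ℕ} (K : Set (Vec p)) : IsEatonRegion K Set.univ :=
  ⟨isClosed_univ, convex_univ, fun _ _ _ _ => trivial⟩

lemma IsEatonRegion.mono {p : ℕ} {K L C : Set (Vec p)} (h : IsEatonRegion L C) (hKL : K ⊆ L) :
    IsEatonRegion K C :=
  ⟨h.1, h.2.1, fun a ha w hw => h.2.2 a ha w (hKL hw)⟩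

/-! ### The dual cone -/

/-- Test `w` against `S⁻¹eᵢ`, the alternative with `θ = eᵢ`. -/
lemma dualCone_subset_pivotCone {p : ℕ} {M : Set (Mat p)} {S : Mat p} (hS : S.PosDef)
    (hSM : S ∈ M) : dualCone M ⊆ pivotCone S := by
  intro w hw i
  have hmem : S⁻¹ *ᵥ Pi.single i 1 ∈ altCone M := by
    have hne : S⁻¹ *ᵥ Pi.single i (1 : ℝ) ≠ 0 := by
      intro h0
      have := mulVec_inv_mulVec hS (Pi.single i 1)
      rw [h0, mulVec_zero] at this
      simpa using congrFun this i
    refine Set.mem_iInter₂.2 fun K hK => hK ⟨⟨S, hSM, Pi.single i 1, ?_, rfl⟩, hne⟩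
    exact Pi.single_nonneg.2 zero_le_one
  have h := hw _ hmem
  rw [dotProduct_mulVec_comm_of_posDef hS.inv] at h
  simpa using h

lemma dualCone_subset_nonpos {p : ℕ} {M : Set (Mat p)} (h1 : 1 ∈ M) :
    dualCone M ⊆ {x | x ≤ 0} := by
  intro w hw
  simpa [pivotCone] using dualCone_subset_pivotCone Matrix.PosDef.one h1 hw

lemma one_mem_posDefs (p : ℕ) : (1 : Mat p) ∈ posDefs p := Matrix.PosDef.one

lemma one_mem_corrs (p : ℕ) : (1 : Mat p) ∈ corrs p := ⟨Matrix.PosDef.one, fun _ => by simp⟩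

/-- Every positive definite `Q` is some `Σ⁻¹`, so `Q w ≤ 0` for all of them; a rank-one perturbation
of the identity violates this if `w ≠ 0`. -/
lemma eq_zero_of_mem_dualCone_posDefs {p : ℕ} (hp : 2 ≤ p) {w : Vec p}
    (hw : w ∈ dualCone (posDefs p)) : w = 0 := by
  by_contra hne
  obtain ⟨i, hi⟩ : ∃ i, w i ≠ 0 := by
    by_contra h
    push Not at h
    exact hne (funext h)
  have : Nontrivial (Fin p) := Fin.nontrivial_iff_two_le.2 hp
  obtain ⟨j, hj⟩ := exists_ne i
  -- The weight on `eᵢ` makes `v·w = w j + 1 + 2|w j|`, so coordinate `j` of `(1 + vv')w` is `2 w j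
  -- + 1 + 2|w j| > 0`.
  set v : Vec p := Pi.single j 1 + Pi.single i ((1 + 2 * |w j|) / w i) with hv
  have hQ : (1 + vecMulVec v v : Mat p).PosDef := by
    refine Matrix.PosDef.one.add_posSemidef ?_
    simpa using posSemidef_vecMulVec_self_star v
  have hmem := dualCone_subset_pivotCone hQ.inv (show _ ∈ posDefs p from hQ.inv) hw
  have hdet := (Matrix.isUnit_iff_isUnit_det _).1 hQ.isUnit
  have h := hmem j
  rw [nonsing_inv_nonsing_inv _ hdet, add_mulVec, one_mulVec, vecMulVec_mulVec] at h
  have hvj : v j = 1 := by simp [hv, hj]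
  have hvw : v ⬝ᵥ w = w j + (1 + 2 * |w j|) := by
    rw [hv, add_dotProduct, single_dotProduct, single_dotProduct, one_mul,
      div_mul_cancel₀ _ hi]
  simp only [Pi.add_apply, Pi.smul_apply, Pi.zero_apply, hvj, hvw, op_smul_eq_smul,
    smul_eq_mul] at h
  linarith [neg_abs_le (w j)]

/-! ### The acceptance region of the union-intersection test -/

lemma mul_le_iff_sqrt_mul_le {c : ℝ} {N m : ℝ} (hN : 0 ≤ N) (hm : 0 ≤ m) {r : ℝ} (hr : 0 ≤ r)
    (hc : r ^ 2 = c) : N * m ≤ c ↔ √N * m ≤ r * √m := by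
  have hNs := Real.sq_sqrt hN
  have hms := Real.sq_sqrt hm
  have h1 := Real.sqrt_nonneg N
  have h2 := Real.sqrt_nonneg m
  have e : N * m = (√N * √m) ^ 2 := by rw [mul_pow, hNs, hms]
  rw [e, ← hc]
  rw [sq_le_sq₀ (by positivity) hr]
  conv_rhs => rw [← hms, pow_two, ← mul_assoc]
  rw [Real.sqrt_mul_self h2]
  constructor
  · intro h
    exact mul_le_mul_of_nonneg_right h h2
  · intro h
    rcases h2.eq_or_lt with h0 | h0
    · rw [← h0]; simpa using hr
    · exact le_of_mul_le_mul_right h h0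

/-- Since `b·x = b·y + l·S b ≤ b·y`, Cauchy–Schwarz gives the bound; it is attained at `b = S⁻¹y`.
-/
lemma mem_uitRegion_iff {p : ℕ} {S : Mat p} (hS : S.PosDef) (n : ℕ) {c : ℝ} (hc : 0 ≤ c)
    (x : Vec p) : x ∈ uitRegion n c S ↔
      ∀ b, 0 ≤ S *ᵥ b → √n * (b ⬝ᵥ x) ≤ √c * √(b ⬝ᵥ S *ᵥ b) := by
  obtain ⟨y, l, h⟩ := exists_isMoreauPair hS x
  obtain ⟨z, hz⟩ : ∃ z, z = S⁻¹ *ᵥ y := ⟨_, rfl⟩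
  have hSz : S *ᵥ z = y := by rw [hz, mulVec_inv_mulVec hS]
  have hm := dotProduct_mulVec_self_nonneg hS z
  have hU : uitStat n x S = n * (z ⬝ᵥ S *ᵥ z) := by
    rw [uitStat_eq hS n h, ← hz, hSz, dotProduct_comm]
  have hbx : ∀ b, b ⬝ᵥ x = b ⬝ᵥ S *ᵥ z + l ⬝ᵥ S *ᵥ b := by
    intro b
    rw [h.eq_add, dotProduct_add, hSz, dotProduct_mulVec_comm_of_posDef hS b l]
  change uitStat n x S ≤ c ↔ _
  rw [hU, mul_le_iff_sqrt_mul_le (Nat.cast_nonneg n) hm (Real.sqrt_nonneg c) (Real.sq_sqrt hc)]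
  constructor
  · intro hle b hb
    rw [← mul_le_iff_sqrt_mul_le (Nat.cast_nonneg n) hm (Real.sqrt_nonneg c) (Real.sq_sqrt hc)] at hle
    have h1 : b ⬝ᵥ x ≤ b ⬝ᵥ S *ᵥ z := by
      have := dotProduct_nonpos_of_nonneg_of_nonpos hb h.nonpos
      rw [dotProduct_comm] at this
      linarith [hbx b]
    have h2 := dotProduct_le_sqrt_mul_sqrt hS b z
    have h3 : √n * √(z ⬝ᵥ S *ᵥ z) ≤ √c := by
      rw [← Real.sqrt_mul (Nat.cast_nonneg n)]
      exact Real.sqrt_le_sqrt hle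
    calc √n * (b ⬝ᵥ x) ≤ √n * (√(b ⬝ᵥ S *ᵥ b) * √(z ⬝ᵥ S *ᵥ z)) := by
          gcongr; exact h1.trans h2
      _ = (√n * √(z ⬝ᵥ S *ᵥ z)) * √(b ⬝ᵥ S *ᵥ b) := by ring
      _ ≤ √c * √(b ⬝ᵥ S *ᵥ b) := by gcongr
  · intro hb
    have h1 := hb z (by rw [hSz]; exact h.nonneg)
    have h2 : z ⬝ᵥ x = z ⬝ᵥ S *ᵥ z := by
      rw [hbx z, hSz, dotProduct_comm l, h.orth, add_zero]
    rwa [h2] at h1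

lemma dotProduct_nonpos_of_mem_pivotCone {p : ℕ} {S : Mat p} (hS : S.PosDef) {b w : Vec p}
    (hb : 0 ≤ S *ᵥ b) (hw : w ∈ pivotCone S) : b ⬝ᵥ w ≤ 0 := by
  have := dotProduct_nonpos_of_nonneg_of_nonpos hb hw
  rw [dotProduct_comm, dotProduct_mulVec_comm_of_posDef hS, dotProduct_comm] at this
  rwa [dotProduct_comm, mulVec_inv_mulVec hS] at this

lemma isEatonRegion_uitRegion {p : ℕ} {S : Mat p} (hS : S.PosDef) (n : ℕ) {c : ℝ}
    (hc : 0 ≤ c) : IsEatonRegion (pivotCone S) (uitRegion n c S) := by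
  refine isEatonRegion_of_halfSpaces (κ := {b : Vec p // 0 ≤ S *ᵥ b}) (fun b => √n • b.1)
    (fun b => √c * √(b.1 ⬝ᵥ S *ᵥ b.1)) (fun x => ?_) (fun b w hw => ?_)
  · rw [mem_uitRegion_iff hS n hc]
    simp [Subtype.forall]
  · rw [smul_dotProduct, smul_eq_mul]
    exact mul_nonpos_of_nonneg_of_nonpos (Real.sqrt_nonneg _)
      (dotProduct_nonpos_of_mem_pivotCone hS b.2 hw)

lemma pivotCone_subset_uitRegion {p : ℕ} {S : Mat p} (hS : S.PosDef) (n : ℕ) {c : ℝ}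
    (hc : 0 ≤ c) : pivotCone S ⊆ uitRegion n c S := by
  intro w hw
  rw [mem_uitRegion_iff hS n hc]
  intro b hb
  have h1 := mul_nonpos_of_nonneg_of_nonpos (Real.sqrt_nonneg (n : ℝ))
    (dotProduct_nonpos_of_mem_pivotCone hS hb hw)
  have h2 : 0 ≤ √c * √(b ⬝ᵥ S *ᵥ b) := by positivity
  linarith

/-- Invariance of the union-intersection test under changes of scale of the coordinates. -/
lemma mem_uitRegion_scale_iff {p : ℕ} {S R : Mat p} (hS : S.PosDef) (hR : R.PosDef) (n : ℕ)
    {c : ℝ} (hc : 0 ≤ c) {d : Vec p} (hd : ∀ i, 0 < d i)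
    (hSR : ∀ i j, S i j = d i * R i j * d j) {x z : Vec p} (hx : ∀ i, x i = d i * z i) :
    x ∈ uitRegion n c S ↔ z ∈ uitRegion n c R := by
  have hmul : ∀ b, S *ᵥ b = fun i => d i * (R *ᵥ fun j => d j * b j) i := by
    intro b
    ext i
    simp only [mulVec, dotProduct, Finset.mul_sum, hSR]
    exact Finset.sum_congr rfl fun j _ => by ring
  have hquad : ∀ b : Vec p, b ⬝ᵥ S *ᵥ b = (fun j => d j * b j) ⬝ᵥ R *ᵥ fun j => d j * b j := by
    intro b
    rw [hmul]
    simp only [dotProduct]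
    exact Finset.sum_congr rfl fun j _ => by ring
  have hlin : ∀ b : Vec p, b ⬝ᵥ x = (fun j => d j * b j) ⬝ᵥ z := by
    intro b
    simp only [dotProduct, hx]
    exact Finset.sum_congr rfl fun j _ => by ring
  have hpos : ∀ b, 0 ≤ S *ᵥ b ↔ 0 ≤ R *ᵥ fun j => d j * b j := by
    intro b
    rw [hmul]
    simp only [Pi.le_def, Pi.zero_apply]
    exact forall_congr' fun i => mul_nonneg_iff_of_pos_left (hd i)
  rw [mem_uitRegion_iff hS n hc, mem_uitRegion_iff hR n hc]
  constructor
  · intro h b hb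
    have e : (fun j => d j * (b j / d j)) = b := by
      ext j
      rw [mul_div_cancel₀ _ (hd j).ne']
    have := h (fun j => b j / d j)
    rw [hpos, hquad, hlin, e] at this
    exact this hb
  · intro h b hb
    rw [hquad, hlin]
    exact h _ ((hpos b).1 hb)

/-! ### The union-intersection test given the matrix of sums of squares -/

/-- The tangent at `v₀` of the concave function `v ↦ v / √(a + c v)`. -/
def tangentAt (a c v₀ v : ℝ) : ℝ :=
  v * (1 / (2 * √(a + c * v₀)) + a / (2 * √(a + c * v₀) ^ 3)) +
    c * v₀ ^ 2 / (2 * √(a + c * v₀) ^ 3)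

lemma tangentAt_self {a c v : ℝ} (ha : 0 < a) (hc : 0 ≤ c) (hv : 0 ≤ v) :
    tangentAt a c v v = v / √(a + c * v) := by
  have h : 0 < a + c * v := by positivity
  have hs := Real.sqrt_pos.2 h
  have hsq := Real.sq_sqrt h.le
  rw [tangentAt]
  set s := √(a + c * v)
  have hne := hs.ne'
  field_simp
  rw [hsq]
  ring

lemma div_sqrt_le_tangentAt {a c v v₀ : ℝ} (ha : 0 < a) (hc : 0 ≤ c) (hv : 0 ≤ v)
    (hv₀ : 0 ≤ v₀) : v / √(a + c * v) ≤ tangentAt a c v₀ v := by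
  rcases hc.eq_or_lt with rfl | hc
  -- For `c = 0` the function is linear and equals its tangent.
  · have h : √(a + 0 * v) = √(a + 0 * v₀) := by simp
    have hs := tangentAt_self (c := 0) ha le_rfl hv
    rw [← hs]
    simp [tangentAt]
  have hr : 0 < a + c * v := by positivity
  have hs : 0 < a + c * v₀ := by positivity
  have hr' := Real.sqrt_pos.2 hr
  have hs' := Real.sqrt_pos.2 hs
  have hrq := Real.sq_sqrt hr.le
  have hsq := Real.sq_sqrt hs.le
  rw [tangentAt]
  set r := √(a + c * v)
  set s := √(a + c * v₀)
  have e1 : v = (r ^ 2 - a) / c := by rw [hrq]; field_simp; ring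
  have e2 : v₀ = (s ^ 2 - a) / c := by rw [hsq]; field_simp; ring
  -- In terms of the two square roots `r`, `s`, the gap between tangent and function has the factor
  -- `(r - s)²`.
  have key : 0 ≤ (r * s ^ 2 * (r - s) ^ 2 + a * (r - s) ^ 2 * (r + 2 * s)) /
      (2 * c * s ^ 3 * r) := by positivity
  have : v * (1 / (2 * s) + a / (2 * s ^ 3)) + c * v₀ ^ 2 / (2 * s ^ 3) - v / r
      = (r * s ^ 2 * (r - s) ^ 2 + a * (r - s) ^ 2 * (r + 2 * s)) / (2 * c * s ^ 3 * r) := by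
    rw [e1, e2]
    field_simp
    ring
  linarith

lemma tangentAt_mono {a c v₀ : ℝ} (ha : 0 ≤ a) : Monotone (tangentAt a c v₀) := by
  intro v w h
  unfold tangentAt
  gcongr

/-- The nonpositive vectors in the polar cone of `K`; they are used to bound the distance to the
orthant. -/
def admissibleDirections {p : ℕ} (K : Set (Vec p)) : Set (Vec p) :=
  {μ | μ ≤ 0 ∧ ∀ w ∈ K, μ ⬝ᵥ w ≤ 0}

/-- An affine upper bound of `1 - n d(x)²`, with `d` the distance to the orthant in the norm of
`W⁻¹`. -/
def orthantGap {p : ℕ} (n : ℕ) (W : Mat p) (μ x : Vec p) : ℝ :=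
  1 - 2 * n * (μ ⬝ᵥ x) + n * (μ ⬝ᵥ W *ᵥ μ)

/-- The section at `W` of the acceptance region of the union-intersection test, when the sample
mean varies for a fixed value `W` of the matrix of sums of squares. -/
def uitSection {p : ℕ} (n : ℕ) (c : ℝ) (K : Set (Vec p)) (W : Mat p) : Set (Vec p) :=
  {x | (∀ μ ∈ admissibleDirections K, 0 ≤ orthantGap n W μ x) ∧
    ∀ μ ∈ admissibleDirections K, ∀ b, 0 ≤ W *ᵥ b → ∀ v₀ : ℝ, 0 ≤ v₀ →
      √n * (b ⬝ᵥ x) ≤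
        √c * √(b ⬝ᵥ W *ᵥ b) * tangentAt ((n : ℝ) - 1) c v₀ (orthantGap n W μ x)}

lemma isEatonRegion_uitSection {p n : ℕ} (hn : 1 ≤ n) (c : ℝ) {K : Set (Vec p)} {W : Mat p}
    (hW : W.PosDef) (hK : K ⊆ pivotCone W) : IsEatonRegion K (uitSection n c K W) := by
  have hn' : (0 : ℝ) ≤ (n : ℝ) - 1 := by
    have : (1 : ℝ) ≤ n := by exact_mod_cast hn
    linarith
  let sl : ℝ → ℝ := fun v₀ => 1 / (2 * √((n : ℝ) - 1 + c * v₀)) +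
    ((n : ℝ) - 1) / (2 * √((n : ℝ) - 1 + c * v₀) ^ 3)
  have hsl : ∀ v₀, 0 ≤ sl v₀ := fun v₀ => by positivity
  have hT : ∀ v₀ v, tangentAt ((n : ℝ) - 1) c v₀ v = v * sl v₀ +
    tangentAt ((n : ℝ) - 1) c v₀ 0 := fun v₀ v => by simp [tangentAt, sl]
  refine isEatonRegion_of_halfSpaces
    (κ := {μ // μ ∈ admissibleDirections K} ⊕
      ({μ // μ ∈ admissibleDirections K} × {b : Vec p // 0 ≤ W *ᵥ b} × {v : ℝ // 0 ≤ v}))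
    (Sum.elim (fun μ => (2 * n : ℝ) • μ.1)
      (fun k => √n • k.2.1.1 +
        (√c * √(k.2.1.1 ⬝ᵥ W *ᵥ k.2.1.1) * sl k.2.2.1 * (2 * n)) • k.1.1))
    (Sum.elim (fun μ => 1 + n * (μ.1 ⬝ᵥ W *ᵥ μ.1))
      (fun k => √c * √(k.2.1.1 ⬝ᵥ W *ᵥ k.2.1.1) *
        ((1 + n * (k.1.1 ⬝ᵥ W *ᵥ k.1.1)) * sl k.2.2.1 +
          tangentAt ((n : ℝ) - 1) c k.2.2.1 0))) ?_ ?_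
  · intro x
    simp only [Sum.forall, Sum.elim_inl, Sum.elim_inr, Prod.forall, Subtype.forall, uitSection,
      Set.mem_ofPred_eq]
    refine and_congr ?_ ?_
    · refine forall₂_congr fun μ _ => ?_
      rw [smul_dotProduct, smul_eq_mul, orthantGap]
      constructor <;> intro h <;> linarith
    · refine forall₂_congr fun μ _ => forall₂_congr fun b _ => forall₂_congr fun v₀ _ => ?_
      rw [add_dotProduct, smul_dotProduct, smul_dotProduct, smul_eq_mul, smul_eq_mul, hT v₀,
        orthantGap]
      constructor <;> intro h <;> linarith
  · rintro (μ | ⟨μ, b, v₀⟩) w hw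
    · simp only [Sum.elim_inl, smul_dotProduct, smul_eq_mul]
      exact mul_nonpos_of_nonneg_of_nonpos (by positivity) (μ.2.2 w hw)
    · simp only [Sum.elim_inr, add_dotProduct, smul_dotProduct, smul_eq_mul]
      have h1 := dotProduct_nonpos_of_mem_pivotCone hW b.2 (hK hw)
      have h2 := μ.2.2 w hw
      have h3 : 0 ≤ √c * √(b.1 ⬝ᵥ W *ᵥ b.1) * sl v₀.1 * (2 * n) := by
        have := hsl v₀.1
        positivity
      exact add_nonpos (mul_nonpos_of_nonneg_of_nonpos (Real.sqrt_nonneg _) h1)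
        (mul_nonpos_of_nonneg_of_nonpos h3 h2)

/-- The difference of the two sides is `n((ν - μ)'W(ν - μ) - 2 ν·y) ≥ 0`. With `orthantGap_eq`, `v`
is the minimum over `ν ≤ 0` of functions affine in `x`. -/
lemma orthantGap_le {p n : ℕ} {W : Mat p} (hW : W.PosDef) {x y μ : Vec p}
    (h : IsMoreauPair W x y μ) {ν : Vec p} (hν : ν ≤ 0) :
    1 - n * (μ ⬝ᵥ W *ᵥ μ) ≤ orthantGap n W ν x := by
  have h1 := dotProduct_mulVec_self_nonneg hW (ν - μ)
  have h2 := dotProduct_nonpos_of_nonneg_of_nonpos h.nonneg hν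
  have hc := dotProduct_mulVec_comm_of_posDef hW μ ν
  rw [dotProduct_comm] at h2
  simp only [mulVec_sub, dotProduct_sub, sub_dotProduct] at h1
  rw [orthantGap, h.eq_add, dotProduct_add]
  have h3 : (0 : ℝ) ≤ n * (ν ⬝ᵥ W *ᵥ ν - 2 * (ν ⬝ᵥ W *ᵥ μ) + μ ⬝ᵥ W *ᵥ μ - 2 * (ν ⬝ᵥ y)) :=
    mul_nonneg (Nat.cast_nonneg n) (by linarith)
  linarith

lemma orthantGap_eq {p n : ℕ} {W : Mat p} {x y μ : Vec p}
    (h : IsMoreauPair W x y μ) : orthantGap n W μ x = 1 - n * (μ ⬝ᵥ W *ᵥ μ) := by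
  rw [orthantGap, h.eq_add, dotProduct_add, dotProduct_comm μ y, h.orth]
  ring

section SumSquares

variable {p n : ℕ} {S W : Mat p} {x y μ : Vec p}

/-- The quantity is `1 - n q` with `q = x'W⁻¹x`, and `(n-1)S` takes the value `q(1 - n q)` at `W⁻¹x
= z + μ`. -/
lemma gap_pos (hn : 2 ≤ n) (hS : S.PosDef) (hW : W.PosDef)
    (hSW : ∀ w, ((n : ℝ) - 1) • (S *ᵥ w) = W *ᵥ w - (n * (x ⬝ᵥ w)) • x)
    (h : IsMoreauPair W x y μ) : 0 < 1 - n * (μ ⬝ᵥ W *ᵥ μ) - n * (y ⬝ᵥ W⁻¹ *ᵥ y) := by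
  have hn' : (0 : ℝ) < (n : ℝ) - 1 := by
    have : (2 : ℝ) ≤ n := by exact_mod_cast hn
    linarith
  obtain ⟨z, hz⟩ : ∃ z, z = W⁻¹ *ᵥ y := ⟨_, rfl⟩
  have hWz : W *ᵥ z = y := by rw [hz, mulVec_inv_mulVec hW]
  have hx : W *ᵥ (z + μ) = x := by rw [mulVec_add, hWz, ← h.eq_add]
  have hQ : x ⬝ᵥ (z + μ) = μ ⬝ᵥ W *ᵥ μ + y ⬝ᵥ z := by
    have e := dotProduct_mulVec_comm_of_posDef hW z μ
    rw [hWz, dotProduct_comm μ y, h.orth] at e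
    rw [h.eq_add, add_dotProduct, dotProduct_add, dotProduct_add, h.orth,
      dotProduct_comm (W *ᵥ μ) z, e, dotProduct_comm (W *ᵥ μ) μ]
    ring
  rw [← hz]
  by_cases h0 : z + μ = 0
  · rw [h0, dotProduct_zero] at hQ
    have : (n : ℝ) * (μ ⬝ᵥ W *ᵥ μ + y ⬝ᵥ z) = 0 := by rw [← hQ, mul_zero]
    linarith
  · have h1 := dotProduct_mulVec_self_pos hW h0
    have h2 := mul_pos hn' (dotProduct_mulVec_self_pos hS h0)
    have h3 := congrArg (fun v => (z + μ) ⬝ᵥ v) (hSW (z + μ))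
    simp only [dotProduct_smul, smul_eq_mul, dotProduct_sub] at h3
    rw [h3, hx, dotProduct_comm (z + μ) x] at h2
    rw [hx, dotProduct_comm (z + μ) x] at h1
    have h4 : 0 < (x ⬝ᵥ (z + μ)) * (1 - n * (x ⬝ᵥ (z + μ))) := by linarith
    have h5 := (mul_pos_iff_of_pos_left h1).1 h4
    rw [hQ] at h5
    linarith

lemma uitStat_eq_of_sumSquares (hn : 2 ≤ n) (hS : S.PosDef) (hW : W.PosDef)
    (hSW : ∀ w, ((n : ℝ) - 1) • (S *ᵥ w) = W *ᵥ w - (n * (x ⬝ᵥ w)) • x)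
    (h : IsMoreauPair W x y μ) {v m : ℝ} (hv : v = 1 - n * (μ ⬝ᵥ W *ᵥ μ))
    (hm : m = y ⬝ᵥ W⁻¹ *ᵥ y) :
    uitStat n x S = n * (((n : ℝ) - 1) * m) / (v * (v - n * m)) := by
  have hn' : (0 : ℝ) < (n : ℝ) - 1 := by
    have : (2 : ℝ) ≤ n := by exact_mod_cast hn
    linarith
  have hgap := gap_pos hn hS hW hSW h
  rw [← hv, ← hm] at hgap
  have hm0 : 0 ≤ m := hm ▸ dotProduct_mulVec_self_nonneg hW.inv y
  have hvpos : 0 < v := by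
    have : 0 ≤ (n : ℝ) * m := by positivity
    linarith
  obtain ⟨z, hz⟩ : ∃ z, z = W⁻¹ *ᵥ y := ⟨_, rfl⟩
  have hWz : W *ᵥ z = y := by rw [hz, mulVec_inv_mulVec hW]
  rw [← hz] at hm
  have hxμ : x ⬝ᵥ μ = μ ⬝ᵥ W *ᵥ μ := by
    rw [h.eq_add, add_dotProduct, h.orth, zero_add, dotProduct_comm]
  have hxz : x ⬝ᵥ z = m := by
    have e := dotProduct_mulVec_comm_of_posDef hW z μ
    rw [hWz, dotProduct_comm μ y, h.orth] at e
    rw [h.eq_add, add_dotProduct, dotProduct_comm (W *ᵥ μ), e, add_zero, hm]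
  have hSμ : ((n : ℝ) - 1) • (S *ᵥ μ) = v • x - y := by
    rw [hSW, hxμ, hv, sub_smul, one_smul]
    generalize (n : ℝ) * (μ ⬝ᵥ W *ᵥ μ) = d
    rw [eq_sub_of_add_eq' h.eq_add.symm]
    abel
  have hSz : ((n : ℝ) - 1) • (S *ᵥ z) = y - (n * m) • x := by rw [hSW, hWz, hxz]
  have hpair : IsMoreauPair S x (v⁻¹ • y) ((((n : ℝ) - 1) / v) • μ) := by
    refine ⟨smul_nonneg (by positivity) h.nonneg, smul_nonpos_of_nonneg_of_nonpos (by positivity)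
      h.nonpos, ?_, ?_⟩
    · rw [smul_dotProduct, dotProduct_smul, h.orth]
      simp
    · rw [mulVec_smul, div_eq_inv_mul, mul_smul, hSμ, ← smul_add, add_sub_cancel, smul_smul,
        inv_mul_cancel₀ hvpos.ne', one_smul]
  -- The weights eliminate `x`: `v(y - nm x) + nm(v x - y) = (v - nm) y`.
  have hSy : S *ᵥ ((((n : ℝ) - 1) / (v - n * m)) • (v • z + (n * m) • μ)) = y := by
    rw [mulVec_smul, mulVec_add, mulVec_smul, mulVec_smul, div_eq_inv_mul, mul_smul, smul_add,
      smul_comm _ v, smul_comm _ ((n : ℝ) * m), hSμ, hSz, smul_sub, smul_sub, smul_comm v,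
      sub_add_sub_cancel, ← sub_smul, smul_smul, inv_mul_cancel₀ hgap.ne', one_smul]
  rw [uitStat_eq hS n hpair]
  have hinv : S⁻¹ *ᵥ y = (((n : ℝ) - 1) / (v - n * m)) • (v • z + (n * m) • μ) := by
    conv_lhs => rw [← hSy]
    rw [inv_mulVec_mulVec hS]
  rw [mulVec_smul, hinv]
  simp only [smul_dotProduct, dotProduct_smul, dotProduct_add, h.orth, smul_eq_mul, ← hm]
  have h1 := hvpos.ne'
  have h2 := hgap.ne'
  field_simp
  ring

lemma mem_uitRegion_iff_mem_uitSection (hn : 2 ≤ n) {c : ℝ} (hc : 0 ≤ c) (hS : S.PosDef)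
    (hW : W.PosDef) (hSW : ∀ w, ((n : ℝ) - 1) • (S *ᵥ w) = W *ᵥ w - (n * (x ⬝ᵥ w)) • x)
    {K : Set (Vec p)}
    (hK : ∀ y μ, IsMoreauPair W x y μ → y = 0 ∨ μ ∈ admissibleDirections K) :
    x ∈ uitRegion n c S ↔ x ∈ uitSection n c K W := by
  have hn' : (0 : ℝ) < (n : ℝ) - 1 := by
    have : (2 : ℝ) ≤ n := by exact_mod_cast hn
    linarith
  obtain ⟨y, μ, h⟩ := exists_isMoreauPair hW x
  obtain ⟨v, hv⟩ : ∃ v, v = 1 - n * (μ ⬝ᵥ W *ᵥ μ) := ⟨_, rfl⟩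
  obtain ⟨m, hm⟩ : ∃ m, m = y ⬝ᵥ W⁻¹ *ᵥ y := ⟨_, rfl⟩
  have hU := uitStat_eq_of_sumSquares hn hS hW hSW h hv hm
  have hgap := gap_pos hn hS hW hSW h
  rw [← hv, ← hm] at hgap
  have hm0 : 0 ≤ m := hm ▸ dotProduct_mulVec_self_nonneg hW.inv y
  have hvpos : 0 < v := by
    have : 0 ≤ (n : ℝ) * m := by positivity
    linarith
  have hden : 0 < (n : ℝ) - 1 + c * v := by positivity
  have hden' := Real.sqrt_pos.2 hden
  obtain ⟨z, hz⟩ : ∃ z, z = W⁻¹ *ᵥ y := ⟨_, rfl⟩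
  have hWz : W *ᵥ z = y := by rw [hz, mulVec_inv_mulVec hW]
  rw [← hz] at hm
  have hzz : z ⬝ᵥ W *ᵥ z = m := by rw [hWz, dotProduct_comm, hm]
  have hbx : ∀ b, b ⬝ᵥ x = b ⬝ᵥ W *ᵥ z + μ ⬝ᵥ W *ᵥ b := by
    intro b
    rw [h.eq_add, dotProduct_add, hWz, dotProduct_mulVec_comm_of_posDef hW b μ]
  have hiff : uitStat n x S ≤ c ↔ n * m ≤ (√c * (v / √((n : ℝ) - 1 + c * v))) ^ 2 := by
    rw [hU, mul_pow, div_pow, Real.sq_sqrt hc, Real.sq_sqrt hden.le, div_le_iff₀ (by positivity),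
      ← mul_div_assoc, le_div_iff₀ hden]
    constructor <;> intro h <;> linarith
  have hr : 0 ≤ √c * (v / √((n : ℝ) - 1 + c * v)) := by positivity
  change uitStat n x S ≤ c ↔ _
  rw [hiff]
  constructor
  · intro hle
    have h3 : √n * √m ≤ √c * (v / √((n : ℝ) - 1 + c * v)) := by
      rw [← Real.sqrt_mul (Nat.cast_nonneg n)]
      exact Real.sqrt_le_iff.2 ⟨hr, hle⟩
    refine ⟨fun ν hν => ?_, fun ν hν b hb v₀ hv₀ => ?_⟩
    · exact hvpos.le.trans (hv ▸ orthantGap_le hW h hν.1)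
    · have h1 : b ⬝ᵥ x ≤ b ⬝ᵥ W *ᵥ z := by
        have := dotProduct_nonpos_of_nonneg_of_nonpos hb h.nonpos
        rw [dotProduct_comm] at this
        linarith [hbx b]
      have h2 := dotProduct_le_sqrt_mul_sqrt hW b z
      rw [hzz] at h2
      have h4 : v / √((n : ℝ) - 1 + c * v) ≤
          tangentAt ((n : ℝ) - 1) c v₀ (orthantGap n W ν x) :=
        (div_sqrt_le_tangentAt hn' hc hvpos.le hv₀).trans
          (tangentAt_mono hn'.le (hv ▸ orthantGap_le hW h hν.1))
      calc √n * (b ⬝ᵥ x) ≤ √n * (√(b ⬝ᵥ W *ᵥ b) * √m) := by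
            gcongr; exact h1.trans h2
        _ = (√n * √m) * √(b ⬝ᵥ W *ᵥ b) := by ring
        _ ≤ (√c * (v / √((n : ℝ) - 1 + c * v))) * √(b ⬝ᵥ W *ᵥ b) := by gcongr
        _ = √c * √(b ⬝ᵥ W *ᵥ b) * (v / √((n : ℝ) - 1 + c * v)) := by ring
        _ ≤ _ := by gcongr
  · rintro ⟨-, hx⟩
    rcases hK y μ h with h0 | hμ
    · rw [hm, h0, zero_dotProduct, mul_zero]
      positivity
    · have h1 := hx μ hμ z (by rw [hWz]; exact h.nonneg) v hvpos.le
      -- At `b = z`, direction `μ` and `v₀ = v`, every affine bound is exact.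
      rw [orthantGap_eq h, ← hv, tangentAt_self hn' hc hvpos.le, hzz, hbx z, hzz, hWz,
        dotProduct_comm μ y, h.orth, add_zero] at h1
      rw [mul_le_iff_sqrt_mul_le (Nat.cast_nonneg n) hm0 hr rfl]
      linarith

end SumSquares

/-! ### Statistics of a sample -/

section Sample

variable {n p : ℕ}

lemma sub_one_smul_sampleCov (hn : 2 ≤ n) (X : Sample n p) :
    ((n : ℝ) - 1) • sampleCov X =
      sumSquares X - (n : ℝ) • vecMulVec (sampleMean X) (sampleMean X) := by
  have hn2 : (2 : ℝ) ≤ n := by exact_mod_cast hn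
  have hn' : (n : ℝ) - 1 ≠ 0 := by linarith
  have hn0 : (n : ℝ) ≠ 0 := by linarith
  rw [sampleCov, smul_smul, mul_inv_cancel₀ hn', one_smul, sumSquares]
  have hsum : ∀ j, ∑ i, X i j = n * sampleMean X j := by
    intro j
    simp only [sampleMean, Pi.smul_apply, Finset.sum_apply, smul_eq_mul]
    field_simp
  ext j k
  simp only [Matrix.sum_apply, Matrix.sub_apply, Matrix.smul_apply, vecMulVec_apply,
    Pi.sub_apply, smul_eq_mul]
  have : ∀ i, (X i j - sampleMean X j) * (X i k - sampleMean X k) =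
      X i j * X i k - sampleMean X k * X i j - sampleMean X j * X i k +
        sampleMean X j * sampleMean X k := fun i => by ring
  simp only [this, Finset.sum_add_distrib, Finset.sum_sub_distrib, ← Finset.mul_sum, hsum,
    Finset.sum_const, Finset.card_univ, Fintype.card_fin, nsmul_eq_mul]
  ring

lemma sumSquares_posDef (hn : 2 ≤ n) {X : Sample n p} (hS : (sampleCov X).PosDef) :
    (sumSquares X).PosDef := by
  have hn2 : (2 : ℝ) ≤ n := by exact_mod_cast hn
  have hn' : (0 : ℝ) < (n : ℝ) - 1 := by linarith
  have h : sumSquares X = ((n : ℝ) - 1) • sampleCov X +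
      (n : ℝ) • vecMulVec (sampleMean X) (sampleMean X) := by
    rw [sub_one_smul_sampleCov hn, sub_add_cancel]
  rw [h]
  refine (hS.smul hn').add_posSemidef (PosSemidef.smul ?_ (Nat.cast_nonneg n))
  simpa using posSemidef_vecMulVec_self_star (sampleMean X)

lemma sub_one_smul_sampleCov_mulVec (hn : 2 ≤ n) (X : Sample n p) (w : Vec p) :
    ((n : ℝ) - 1) • (sampleCov X *ᵥ w) =
      sumSquares X *ᵥ w - (n * (sampleMean X ⬝ᵥ w)) • sampleMean X := by
  rw [← smul_mulVec, sub_one_smul_sampleCov hn, sub_mulVec, smul_mulVec, vecMulVec_mulVec,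
    op_smul_eq_smul, smul_smul]

lemma sampleCov_eq_sampleCorr {X : Sample n p} (hS : (sampleCov X).PosDef) (i j : Fin p) :
    sampleCov X i j = √(sampleCov X i i) * sampleCorr X i j * √(sampleCov X j j) := by
  have hi := Real.sqrt_pos.2 (hS.diag_pos (i := i))
  have hj := Real.sqrt_pos.2 (hS.diag_pos (i := j))
  rw [sampleCorr, Matrix.of_apply]
  field_simp

lemma sampleCorr_mem_corrs {X : Sample n p} (hS : (sampleCov X).PosDef) :
    sampleCorr X ∈ corrs p := by
  have hd : ∀ i, 0 < √(sampleCov X i i) := fun i => Real.sqrt_pos.2 hS.diag_pos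
  constructor
  · let D : Mat p := diagonal fun i => (√(sampleCov X i i))⁻¹
    have e : sampleCorr X = Dᴴ * sampleCov X * D := by
      ext i j
      simp only [D, conjTranspose_eq_transpose_of_trivial, diagonal_transpose, mul_diagonal,
        diagonal_mul, sampleCorr, of_apply]
      rw [div_eq_mul_inv, mul_inv]
      ring
    rw [e]
    refine hS.conjTranspose_mul_mul_same fun v w h => ?_
    ext i
    have := congrFun h i
    simp only [D, mulVec_diagonal] at this
    exact mul_left_cancel₀ (inv_ne_zero (hd i).ne') this
  · intro i
    have := hd i
    have hpos := hS.diag_pos (i := i)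
    rw [sampleCorr, of_apply, Real.mul_self_sqrt hpos.le, div_self hpos.ne']

lemma sampleMean_eq_scaledMean {X : Sample n p} (hS : (sampleCov X).PosDef) (j : Fin p) :
    sampleMean X j = √(sampleCov X j j) * scaledMean X j := by
  have hj := Real.sqrt_pos.2 (hS.diag_pos (i := j))
  rw [scaledMean, mul_div_cancel₀ _ hj.ne']

end Sample

/-! ### Measurability of the tests -/

section Measurability

variable {Ω : Type*} [MeasurableSpace Ω]

lemma measurable_det {m : Type*} [Fintype m] [DecidableEq m] {A : Ω → Matrix m m ℝ}
    (hA : ∀ i j, Measurable fun ω => A ω i j) : Measurable fun ω => (A ω).det := by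
  simp only [det_apply]
  refine Finset.measurable_sum _ fun σ _ => ?_
  simp only [Units.smul_def, zsmul_eq_mul]
  exact (Finset.measurable_prod _ fun i _ => hA _ _).const_mul _

lemma measurable_inv_apply {m : Type*} [Fintype m] [DecidableEq m] {A : Ω → Matrix m m ℝ}
    (hA : ∀ i j, Measurable fun ω => A ω i j) (i j : m) :
    Measurable fun ω => (A ω)⁻¹ i j := by
  -- Cramer's rule; singular matrices do no harm, as the scalar inverse is measurable with `0⁻¹ =
  -- 0`.
  simp only [inv_def, Matrix.smul_apply, Ring.inverse_eq_inv, smul_eq_mul, adjugate_apply]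
  refine (measurable_det hA).inv.mul (measurable_det fun k l => ?_)
  by_cases hk : k = j
  · subst hk
    simp
  · simpa [updateRow_ne hk] using hA k l

lemma measurable_mulVec_apply {l m : Type*} [Fintype m] {A : Ω → Matrix l m ℝ} {v : Ω → m → ℝ}
    (hA : ∀ i j, Measurable fun ω => A ω i j) (hv : ∀ j, Measurable fun ω => v ω j) (i : l) :
    Measurable fun ω => (A ω *ᵥ v ω) i :=
  Finset.measurable_sum _ fun j _ => (hA i j).mul (hv j)

lemma measurable_mul_apply {k l m : Type*} [Fintype l] {A : Ω → Matrix k l ℝ}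
    {B : Ω → Matrix l m ℝ} (hA : ∀ i j, Measurable fun ω => A ω i j)
    (hB : ∀ i j, Measurable fun ω => B ω i j) (i : k) (j : m) :
    Measurable fun ω => (A ω * B ω) i j := by
  simp only [mul_apply]
  exact Finset.measurable_sum _ fun a _ => (hA i a).mul (hB a j)

variable {p : ℕ} {x : Ω → Vec p} {S : Ω → Mat p}

lemma measurable_resVec_apply (hx : ∀ i, Measurable fun ω => x ω i)
    (hS : ∀ i j, Measurable fun ω => S ω i j) (a : Finset (Fin p)) (i : {i // i ∈ a}) :
    Measurable fun ω => resVec (x ω) (S ω) a i := by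
  simp only [resVec, Pi.sub_apply]
  exact (hx _).sub (measurable_mulVec_apply (fun _ _ => hS _ _)
    (measurable_mulVec_apply (measurable_inv_apply fun _ _ => hS _ _) fun _ => hx _) i)

lemma measurable_resMat_apply (hS : ∀ i j, Measurable fun ω => S ω i j) (a : Finset (Fin p))
    (i j : {i // i ∈ a}) : Measurable fun ω => resMat (S ω) a i j := by
  simp only [resMat, Matrix.sub_apply]
  exact (hS _ _).sub (measurable_mul_apply (measurable_mul_apply (fun _ _ => hS _ _)
    (measurable_inv_apply fun _ _ => hS _ _)) (fun _ _ => hS _ _) i j)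

lemma measurable_uitStat (n : ℕ) (hx : ∀ i, Measurable fun ω => x ω i)
    (hS : ∀ i j, Measurable fun ω => S ω i j) :
    Measurable fun ω => uitStat n (x ω) (S ω) := by
  unfold uitStat
  refine Finset.measurable_sum _ fun a _ => Measurable.ite ?_ ?_ measurable_const
  · have h1 : MeasurableSet {ω | ∀ i, 0 < resVec (x ω) (S ω) a i} := by
      rw [Set.ofPred_forall]
      exact MeasurableSet.iInter fun i =>
        measurableSet_lt measurable_const (measurable_resVec_apply hx hS a i)
    have h2 : MeasurableSet {ω | ∀ i, (((S ω).toBlock (· ∉ a) (· ∉ a))⁻¹ *ᵥ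
        fun i : {i // i ∉ a} => x ω i) i ≤ 0} := by
      rw [Set.ofPred_forall]
      exact MeasurableSet.iInter fun i => measurableSet_le
        (measurable_mulVec_apply (measurable_inv_apply fun _ _ => hS _ _) (fun _ => hx _) i)
        measurable_const
    exact h1.inter h2
  · refine Measurable.const_mul ?_ _
    simp only [dotProduct]
    exact Finset.measurable_sum _ fun i _ => (measurable_resVec_apply hx hS a i).mul
      (measurable_mulVec_apply (measurable_inv_apply (measurable_resMat_apply hS a))
        (measurable_resVec_apply hx hS a) i)

lemma measurable_sampleMean_apply {n p : ℕ} (j : Fin p) :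
    Measurable fun X : Sample n p => sampleMean X j := by
  simp only [sampleMean, Pi.smul_apply, Finset.sum_apply]
  fun_prop

lemma measurable_sampleCov_apply {n p : ℕ} (i j : Fin p) :
    Measurable fun X : Sample n p => sampleCov X i j := by
  simp only [sampleCov, Matrix.smul_apply, Matrix.sum_apply, vecMulVec_apply, Pi.sub_apply,
    smul_eq_mul]
  have h := fun k => measurable_sampleMean_apply (n := n) (p := p) k
  refine Measurable.const_mul (Finset.measurable_sum _ fun k _ => ?_) _
  exact (Measurable.sub (by fun_prop) (h i)).mul (Measurable.sub (by fun_prop) (h j))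

lemma measurable_uitTest (n p : ℕ) (c : ℝ) : Measurable (uitTest n p c) := by
  unfold uitTest uitRegion
  exact Measurable.ite (measurableSet_le
    (measurable_uitStat n measurable_sampleMean_apply measurable_sampleCov_apply)
    measurable_const) measurable_const measurable_const

lemma measurable_fuitTest (n p : ℕ) (t : ℝ) : Measurable (fuitTest n p t) := by
  unfold fuitTest tStat
  refine Measurable.ite ?_ measurable_const measurable_const
  rw [Set.ofPred_exists]
  exact MeasurableSet.iUnion fun j => measurableSet_le measurable_const
    (((measurable_sampleMean_apply j).const_mul _).div (measurable_sampleCov_apply j j).sqrt)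

end Measurability

/-! ### The union-intersection test belongs to Eaton's class -/

lemma uitTest_mem_Icc (n p : ℕ) (c : ℝ) (X : Sample n p) :
    uitTest n p c X ∈ Set.Icc (0 : ℝ) 1 := by
  unfold uitTest
  split_ifs <;> simp

/-- Only values of `T` attained at a positive definite sample matter; for any other value the whole
space serves as `C`. -/
lemma uitTest_mem_eatonClass {n p : ℕ} {c : ℝ} {M : Set (Mat p)} {y : Sample n p → Vec p}
    {T : Sample n p → Mat p} (h : ∀ X : Sample n p, (sampleCov X).PosDef →
      ∃ C : Set (Vec p), IsEatonRegion (dualCone M) C ∧ ∀ Y : Sample n p,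
        (sampleCov Y).PosDef → T Y = T X →
          (sampleMean Y ∈ uitRegion n c (sampleCov Y) ↔ y Y ∈ C)) :
    uitTest n p c ∈ eatonClass M y T := by
  refine ⟨measurable_uitTest n p c, uitTest_mem_Icc n p c, fun τ => ?_⟩
  by_cases hτ : ∃ X : Sample n p, (sampleCov X).PosDef ∧ T X = τ
  · obtain ⟨X, hX, rfl⟩ := hτ
    obtain ⟨C, hC, hiff⟩ := h X hX
    refine ⟨C, hC, fun Y hY hT => ⟨fun hn => ?_, fun hi => ?_⟩⟩
    · rw [uitTest, if_neg fun hm => hn ((hiff Y hY hT).1 hm)]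
    · rw [uitTest, if_pos ((hiff Y hY hT).2 (interior_subset hi))]
  · exact ⟨Set.univ, isEatonRegion_univ _, fun X hX hT => absurd ⟨X, hX, hT⟩ hτ⟩

lemma eq_zero_or_mem_admissibleDirections {p : ℕ} {W : Mat p} {x y μ : Vec p}
    (h : IsMoreauPair W x y μ) : y = 0 ∨ μ ∈ admissibleDirections (dualCone (posDefs p)) := by
  by_cases hp : 2 ≤ p
  · refine Or.inr ⟨h.nonpos, fun w hw => ?_⟩
    rw [eq_zero_of_mem_dualCone_posDefs hp hw, dotProduct_zero]
  · have : Subsingleton (Fin p) := Fin.subsingleton_iff_le_one.2 (by omega)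
    by_cases hμ : μ = 0
    · refine Or.inr ⟨h.nonpos, fun w _ => ?_⟩
      rw [hμ, zero_dotProduct]
    · refine Or.inl (funext fun i => ?_)
      rcases mul_eq_zero.1 (h.apply_mul_apply_eq_zero i) with h0 | h0
      · exact h0
      · exact absurd (funext fun j => by rw [Subsingleton.elim j i, h0]; rfl) hμ

lemma uitTest_mem_eatonClass_sumSquares {n : ℕ} (p : ℕ) (hn : 2 ≤ n) {c : ℝ} (hc : 0 ≤ c) :
    uitTest n p c ∈ eatonClass (posDefs p) sampleMean sumSquares := by
  refine uitTest_mem_eatonClass fun X hX => ?_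
  have hW := sumSquares_posDef hn hX
  refine ⟨uitSection n c (dualCone (posDefs p)) (sumSquares X),
    isEatonRegion_uitSection (by omega) c hW (dualCone_subset_pivotCone hW hW),
    fun Y hY hT => ?_⟩
  exact mem_uitRegion_iff_mem_uitSection hn hc hY hW
    (fun w => hT ▸ sub_one_smul_sampleCov_mulVec hn Y w)
    fun _ _ => eq_zero_or_mem_admissibleDirections

lemma uitTest_mem_eatonClass_sampleCov (n p : ℕ) {c : ℝ} (hc : 0 ≤ c) :
    uitTest n p c ∈ eatonClass (posDefs p) sampleMean sampleCov := by
  refine uitTest_mem_eatonClass fun X hX => ⟨uitRegion n c (sampleCov X),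
    (isEatonRegion_uitRegion hX n hc).mono (dualCone_subset_pivotCone hX hX), fun Y _ hT => ?_⟩
  rw [hT]

lemma uitTest_mem_eatonClass_sampleCorr (n p : ℕ) {c : ℝ} (hc : 0 ≤ c) :
    uitTest n p c ∈ eatonClass (corrs p) scaledMean sampleCorr := by
  refine uitTest_mem_eatonClass fun X hX => ?_
  have hR := sampleCorr_mem_corrs hX
  refine ⟨uitRegion n c (sampleCorr X),
    (isEatonRegion_uitRegion hR.1 n hc).mono (dualCone_subset_pivotCone hR.1 hR),
    fun Y hY hT => ?_⟩
  exact mem_uitRegion_scale_iff hY hR.1 n hc (fun i => Real.sqrt_pos.2 hY.diag_pos)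
    (fun i j => hT ▸ sampleCov_eq_sampleCorr hY i j) (sampleMean_eq_scaledMean hY)

/-! ### The finite union-intersection test belongs to Eaton's class -/

lemma isEatonRegion_Iic {p : ℕ} (k : Vec p) :
    IsEatonRegion {x | x ≤ 0} {x : Vec p | ∀ j, x j ≤ k j} :=
  isEatonRegion_of_halfSpaces (fun j => Pi.single j 1) k (fun x => by simp)
    fun j w hw => by simpa using hw j

lemma lt_of_mem_interior {p : ℕ} {k x : Vec p}
    (hx : x ∈ interior {x : Vec p | ∀ j, x j ≤ k j}) (j : Fin p) : x j < k j := by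
  have e : {x : Vec p | ∀ j, x j ≤ k j} = Set.univ.pi fun j => Set.Iic (k j) := by
    ext; simp [Pi.le_def]
  rw [e, interior_pi_set Set.finite_univ] at hx
  simpa using hx j trivial

lemma fuitTest_mem_Icc (n p : ℕ) (t : ℝ) (X : Sample n p) :
    fuitTest n p t X ∈ Set.Icc (0 : ℝ) 1 := by
  unfold fuitTest
  split_ifs <;> simp

/-- Rejection at equality is harmless: such points lie on the boundary of the closed orthant, where
the class leaves the test free. -/
lemma fuitTest_mem_eatonClass {n p : ℕ} {t : ℝ} {M : Set (Mat p)} (h1 : 1 ∈ M)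
    {y : Sample n p → Vec p} {T : Sample n p → Mat p} (k : Mat p → Vec p)
    (h : ∀ X : Sample n p, (sampleCov X).PosDef → ∀ j,
      (t ≤ tStat n (sampleMean X) (sampleCov X) j ↔ k (T X) j ≤ y X j)) :
    fuitTest n p t ∈ eatonClass M y T := by
  refine ⟨measurable_fuitTest n p t, fuitTest_mem_Icc n p t, fun τ =>
    ⟨{x | ∀ j, x j ≤ k τ j}, (isEatonRegion_Iic _).mono (dualCone_subset_nonpos h1), ?_⟩⟩
  rintro X hX rfl
  refine ⟨fun hy => ?_, fun hy => ?_⟩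
  · obtain ⟨j, hj⟩ : ∃ j, k (T X) j < y X j := by simpa using hy
    rw [fuitTest, if_pos ⟨j, (h X hX j).2 hj.le⟩]
  · rw [fuitTest, if_neg]
    rintro ⟨j, hj⟩
    exact absurd ((h X hX j).1 hj) (not_le.2 (lt_of_mem_interior hy j))

lemma le_sqrt_mul_div_iff {N x s t : ℝ} (hN : 0 < N) (hs : 0 < s) :
    t ≤ √N * x / √s ↔ t * √s / √N ≤ x := by
  rw [le_div_iff₀ (Real.sqrt_pos.2 hs), div_le_iff₀ (Real.sqrt_pos.2 hN), mul_comm x]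

lemma sqrt_mul_div_le_iff {N x s t : ℝ} (hN : 0 < N) (hs : 0 < s) :
    √N * x / √s ≤ t ↔ x ≤ t * √s / √N := by
  rw [div_le_iff₀ (Real.sqrt_pos.2 hs), le_div_iff₀ (Real.sqrt_pos.2 hN), mul_comm x]

lemma strictMono_div_sqrt_add_sq {a : ℝ} (ha : 0 < a) :
    StrictMono fun t : ℝ => t / √(a + t ^ 2) := by
  intro t q htq
  have h1 : 0 < a + t ^ 2 := by positivity
  have h2 : 0 < a + q ^ 2 := by positivity
  have hr := Real.sqrt_pos.2 h1
  have hs := Real.sqrt_pos.2 h2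
  have hr2 := Real.sq_sqrt h1.le
  have hs2 := Real.sq_sqrt h2.le
  change t / √(a + t ^ 2) < q / √(a + q ^ 2)
  rw [div_lt_div_iff₀ hr hs]
  have ht : |t| < √(a + t ^ 2) := abs_lt_of_sq_lt_sq (by rw [hr2]; linarith) hr.le
  have hq : |q| < √(a + q ^ 2) := abs_lt_of_sq_lt_sq (by rw [hs2]; linarith) hs.le
  set r := √(a + t ^ 2)
  set s := √(a + q ^ 2)
  -- Uses `r² - t² = s² - q² = a`; the right side is positive because `|t| < r` and `|q| < s`.
  have e : 2 * (q * r - t * s) * (r + s) = (q - t) * ((r + s) ^ 2 - (q + t) ^ 2) := by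
    linear_combination (q + t) * hr2 - (q + t) * hs2
  have hlt : (q + t) ^ 2 < (r + s) ^ 2 := by
    rw [abs_lt] at ht hq
    exact sq_lt_sq' (by linarith [ht.1, hq.1]) (by linarith [ht.2, hq.2])
  have hpos : 0 < 2 * (q * r - t * s) * (r + s) := by
    rw [e]
    exact mul_pos (sub_pos.2 htq) (sub_pos.2 hlt)
  have := pos_of_mul_pos_left hpos (by positivity)
  linarith

/-- With `q` the t-statistic, `w = s(N - 1 + q²)`, so `x = √w q/√(N(N - 1 + q²))` is increasing in
`q` for fixed `w`. -/
lemma le_sqrt_mul_div_iff_of_sumSquares {N x s w t : ℝ} (hN : 1 < N) (hs : 0 < s)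
    (hw : (N - 1) * s = w - N * x ^ 2) :
    t ≤ √N * x / √s ↔ t * √w / √(N * (N - 1 + t ^ 2)) ≤ x := by
  have hN0 : 0 < N := by linarith
  have ha : 0 < N - 1 := by linarith
  obtain ⟨q, hq⟩ : ∃ q, q = √N * x / √s := ⟨_, rfl⟩
  have hs' := Real.sqrt_pos.2 hs
  have hN' := Real.sqrt_pos.2 hN0
  have hx : x = q * √s / √N := by rw [hq]; field_simp
  have hw' : w = s * (N - 1 + q ^ 2) := by
    have : q ^ 2 = N * x ^ 2 / s := by
      rw [hq, div_pow, mul_pow, Real.sq_sqrt hN0.le, Real.sq_sqrt hs.le]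
    rw [this]
    field_simp
    linarith
  rw [← hq, ← (strictMono_div_sqrt_add_sq ha).le_iff_le, hw', Real.sqrt_mul hs.le,
    Real.sqrt_mul hN0.le]
  have h1 : 0 < √(N - 1 + t ^ 2) := Real.sqrt_pos.2 (by positivity)
  have h2 : 0 < √(N - 1 + q ^ 2) := Real.sqrt_pos.2 (by positivity)
  rw [hx, div_le_div_iff₀ h1 h2, div_le_div_iff₀ (by positivity) hN']
  have e1 : t * (√s * √(N - 1 + q ^ 2)) * √N = t * √(N - 1 + q ^ 2) * (√s * √N) := by ring
  have e2 : q * √s * (√N * √(N - 1 + t ^ 2)) = q * √(N - 1 + t ^ 2) * (√s * √N) := by ring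
  rw [e1, e2]
  exact (mul_le_mul_iff_left₀ (by positivity)).symm

lemma fuitTest_mem_eatonClass_sumSquares {n : ℕ} (p : ℕ) (hn : 2 ≤ n) (t : ℝ) :
    fuitTest n p t ∈ eatonClass (posDefs p) sampleMean sumSquares := by
  refine fuitTest_mem_eatonClass (one_mem_posDefs p)
    (fun W j => t * √(W j j) / √((n : ℝ) * ((n : ℝ) - 1 + t ^ 2))) fun X hX j => ?_
  refine le_sqrt_mul_div_iff_of_sumSquares (by exact_mod_cast hn) hX.diag_pos ?_
  have := congrFun (congrFun (sub_one_smul_sampleCov hn X) j) j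
  simpa [vecMulVec_apply, pow_two] using this

lemma fuitTest_mem_eatonClass_sampleCov {n : ℕ} (p : ℕ) (hn : 0 < n) (t : ℝ) :
    fuitTest n p t ∈ eatonClass (posDefs p) sampleMean sampleCov :=
  fuitTest_mem_eatonClass (one_mem_posDefs p) (fun S j => t * √(S j j) / √(n : ℝ))
    fun _ hX _ => le_sqrt_mul_div_iff (by exact_mod_cast hn) hX.diag_pos

lemma fuitTest_mem_eatonClass_sampleCorr {n : ℕ} (p : ℕ) (hn : 0 < n) (t : ℝ) :
    fuitTest n p t ∈ eatonClass (corrs p) scaledMean sampleCorr := by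
  refine fuitTest_mem_eatonClass (one_mem_corrs p) (fun _ _ => t / √(n : ℝ)) fun X hX j => ?_
  rw [tStat, mul_div_assoc, div_le_iff₀ (Real.sqrt_pos.2 (by exact_mod_cast hn)), mul_comm]
  rfl

lemma fuitRegion_eq {n p : ℕ} (hn : 0 < n) (t : ℝ) {S : Mat p} (hS : S.PosDef) :
    fuitRegion n t S = {x | ∀ j, x j ≤ t * √(S j j) / √(n : ℝ)} := by
  ext
  exact forall_congr' fun j => sqrt_mul_div_le_iff (by exact_mod_cast hn) hS.diag_pos

lemma nonpos_subset_fuitRegion {n p : ℕ} {t : ℝ} (ht : 0 ≤ t) (S : Mat p) :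
    {x | x ≤ 0} ⊆ fuitRegion n t S := fun _ hx j =>
  (div_nonpos_of_nonpos_of_nonneg (mul_nonpos_of_nonneg_of_nonpos (Real.sqrt_nonneg _) (hx j))
    (Real.sqrt_nonneg _)).trans ht

/-! ### Student's t-distribution -/

lemma half_le_gaussianReal_Ici : ENNReal.ofReal (1 / 2) ≤ gaussianReal 0 1 (Set.Ici 0) := by
  have hsymm : gaussianReal 0 1 (Set.Iic 0) = gaussianReal 0 1 (Set.Ici 0) := by
    have h := gaussianReal_map_neg (μ := 0) (v := 1)
    rw [neg_zero] at h
    conv_lhs => rw [← h]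
    rw [Measure.map_apply measurable_neg measurableSet_Iic]
    congr 1
    ext x
    simp
  have hone : (1 : ENNReal) ≤ gaussianReal 0 1 (Set.Ici 0) + gaussianReal 0 1 (Set.Ici 0) := by
    nth_rewrite 1 [← hsymm]
    rw [← measure_univ (μ := gaussianReal 0 1), ← Set.Iic_union_Ici (a := (0 : ℝ))]
    exact measure_union_le _ _
  rw [ENNReal.ofReal_div_of_pos two_pos, ENNReal.ofReal_one, ENNReal.ofReal_ofNat]
  refine ENNReal.div_le_of_le_mul ?_
  rwa [mul_two]

lemma gaussianReal_Ico_pos {s t : ℝ} (h : s < t) : 0 < gaussianReal 0 1 (Set.Ico s t) := by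
  rw [pos_iff_ne_zero]
  intro h0
  have := gaussianReal_absolutelyContinuous' 0 one_ne_zero h0
  rw [Real.volume_Ico, ENNReal.ofReal_eq_zero] at this
  linarith

lemma gammaMeasure_Ici_pos {a r x : ℝ} (ha : 0 < a) (hr : 0 < r) (hx : 0 < x) :
    0 < gammaMeasure a r (Set.Ici x) := by
  rw [pos_iff_ne_zero]
  intro h0
  rw [gammaMeasure, withDensity_apply _ measurableSet_Ici] at h0
  unfold gammaPDF at h0
  rw [setLIntegral_eq_zero_iff measurableSet_Ici
      (measurable_gammaPDFReal a r).ennreal_ofReal] at h0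
  have hne : ∀ᵐ y, y ∉ Set.Ici x := by
    filter_upwards [h0] with y hy hmem
    have h1 := hy hmem
    rw [ENNReal.ofReal_eq_zero] at h1
    exact absurd (gammaPDFReal_pos ha hr (hx.trans_le hmem)) (not_lt.2 h1)
  have : (volume : Measure ℝ) (Set.Ici x) = 0 := by
    have := measure_eq_zero_iff_ae_notMem.2 hne
    exact this
  simp at this

/-- The event contains `Z ≥ 0`, of mass at least one half, and the disjoint event `t ≤ Z < 0`, `Y ≥
ν`, of positive mass, where the divisor is at least one. -/
lemma half_lt_studentT_Ici {ν : ℕ} (hν : 0 < ν) {t : ℝ} (ht : t < 0) :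
    ENNReal.ofReal (1 / 2) < studentT ν (Set.Ici t) := by
  have hν' : (0 : ℝ) < ν := by exact_mod_cast hν
  have := isProbabilityMeasure_gammaMeasure (half_pos hν') (one_half_pos (α := ℝ))
  have hmeas : Measurable fun w : ℝ × ℝ => w.1 / √(w.2 / ν) := by fun_prop
  rw [studentT, Measure.map_apply hmeas measurableSet_Ici]
  have hsub : Set.Ici (0 : ℝ) ×ˢ Set.univ ∪ Set.Ico t 0 ×ˢ Set.Ici (ν : ℝ) ⊆
      (fun w : ℝ × ℝ => w.1 / √(w.2 / ν)) ⁻¹' Set.Ici t := by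
    rintro ⟨z, y⟩ (⟨hz, -⟩ | ⟨hz, hy⟩)
    · exact ht.le.trans (div_nonneg hz (Real.sqrt_nonneg _))
    · have h1 : 1 ≤ √(y / ν) := Real.one_le_sqrt.2 ((one_le_div hν').2 hy)
      change t ≤ z / √(y / ν)
      rw [le_div_iff₀ (by linarith)]
      have h2 : t * √(y / ν) ≤ t * 1 := mul_le_mul_of_nonpos_left h1 ht.le
      have h3 : t ≤ z := hz.1
      linarith
  refine lt_of_lt_of_le ?_ (measure_mono hsub)
  rw [measure_union ?_ (measurableSet_Ico.prod measurableSet_Ici), Measure.prod_prod,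
    Measure.prod_prod, measure_univ, mul_one]
  · refine lt_of_le_of_lt half_le_gaussianReal_Ici (ENNReal.lt_add_right (measure_ne_top _ _) ?_)
    exact mul_ne_zero (gaussianReal_Ico_pos ht).ne'
      (gammaMeasure_Ici_pos (half_pos hν') one_half_pos hν').ne'
  · rw [Set.disjoint_left]
    rintro ⟨z, y⟩ ⟨hz, -⟩ ⟨hz', -⟩
    exact absurd hz'.2 (not_lt.2 hz)

lemma IsUpperTPoint.nonneg {ν : ℕ} (hν : 0 < ν) {β t : ℝ} (h : IsUpperTPoint ν β t)
    (hβ : β ≤ 1 / 2) : 0 ≤ t := by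
  by_contra! ht
  have := half_lt_studentT_Ici hν ht
  rw [h] at this
  exact absurd (ENNReal.ofReal_le_ofReal hβ) (not_le.2 this)

end OneSidedMean

end

theorem theorem4p2 (n p : ℕ) (hp : 1 ≤ p) (hn : p < n)
    (c : ℝ) (hc : 0 ≤ c)
    (α : ℝ) (hα0 : 0 < α) (hα1 : α < 1)
    (t : ℝ) (ht : OneSidedMean.IsUpperTPoint (n - 1) (α / p) t) :
    -- the UIT belongs to Eaton's class
    (OneSidedMean.uitTest n p c ∈ OneSidedMean.eatonClass (OneSidedMean.posDefs p)
        OneSidedMean.sampleMean OneSidedMean.sumSquares ∧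
      OneSidedMean.uitTest n p c ∈ OneSidedMean.eatonClass (OneSidedMean.posDefs p)
        OneSidedMean.sampleMean OneSidedMean.sampleCov ∧
      OneSidedMean.uitTest n p c ∈ OneSidedMean.eatonClass (OneSidedMean.corrs p)
        OneSidedMean.scaledMean OneSidedMean.sampleCorr) ∧
    -- the FUIT belongs to Eaton's class
    (OneSidedMean.fuitTest n p t ∈ OneSidedMean.eatonClass (OneSidedMean.posDefs p)
        OneSidedMean.sampleMean OneSidedMean.sumSquares ∧
      OneSidedMean.fuitTest n p t ∈ OneSidedMean.eatonClass (OneSidedMean.posDefs p)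
        OneSidedMean.sampleMean OneSidedMean.sampleCov ∧
      OneSidedMean.fuitTest n p t ∈ OneSidedMean.eatonClass (OneSidedMean.corrs p)
        OneSidedMean.scaledMean OneSidedMean.sampleCorr) ∧
    -- the acceptance regions contain the dual cone, also after a shift of a boundary point to 0
    (∀ M : Set (OneSidedMean.Mat p), M ⊆ OneSidedMean.posDefs p → 1 ∈ M → ∀ S ∈ M,
      (OneSidedMean.dualCone M ⊆ OneSidedMean.pivotCone S ∧
        OneSidedMean.pivotCone S ⊆ OneSidedMean.uitRegion n c S ∧
        OneSidedMean.IsEatonRegion (OneSidedMean.pivotCone S)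
          (OneSidedMean.uitRegion n c S)) ∧
      (OneSidedMean.dualCone M ⊆ {x | x ≤ 0} ∧
        (α ≤ p / 2 → {x | x ≤ 0} ⊆ OneSidedMean.fuitRegion n t S) ∧
        OneSidedMean.IsEatonRegion {x | x ≤ 0} (OneSidedMean.fuitRegion n t S))) := by
  have hn2 : 2 ≤ n := by omega
  have hn0 : 0 < n := by omega
  refine ⟨⟨OneSidedMean.uitTest_mem_eatonClass_sumSquares p hn2 hc,
    OneSidedMean.uitTest_mem_eatonClass_sampleCov n p hc,
    OneSidedMean.uitTest_mem_eatonClass_sampleCorr n p hc⟩,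
    ⟨OneSidedMean.fuitTest_mem_eatonClass_sumSquares p hn2 t,
      OneSidedMean.fuitTest_mem_eatonClass_sampleCov p hn0 t,
      OneSidedMean.fuitTest_mem_eatonClass_sampleCorr p hn0 t⟩, ?_⟩
  intro M hM h1 S hSM
  have hS : S.PosDef := hM hSM
  refine ⟨⟨OneSidedMean.dualCone_subset_pivotCone hS hSM,
    OneSidedMean.pivotCone_subset_uitRegion hS n hc,
    OneSidedMean.isEatonRegion_uitRegion hS n hc⟩,
    OneSidedMean.dualCone_subset_nonpos h1, fun hα => ?_, ?_⟩
  · have hp' : (0 : ℝ) < p := by exact_mod_cast hp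
    refine OneSidedMean.nonpos_subset_fuitRegion (ht.nonneg (by omega) ?_) S
    rw [div_le_iff₀ hp']
    linarith
  · rw [OneSidedMean.fuitRegion_eq hn0 t hS]
    exact OneSidedMean.isEatonRegion_Iic _
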